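/- Let $R$ be a local, not necessarily commutative, ring, that is, a ring with a unique maximal left ideal $\mathfrak m$; then $\mathfrak m$ is two-sided and $d=R/\mathfrak m$ is a skew field. Write $[a]\in d$ for the class of $a\in R$. Suppose that $\mathfrak m^2=0$ and that $\mathfrak m=Rx=xR$ for every nonzero $x\in\mathfrak m$. Then every nonzero $x\in\mathfrak m$ determines an automorphism $\sigma_x$ of $d$, characterized by $\sigma_x([t])=[s]$ whenever $s,t\in R$ satisfy $xt=sx$. Call $r\in d$ admissible for $x$ if $r\neq 0$, $\sigma_x(r)=r$, and $\sigma_x^3(t)=r^{-1}tr$ for all $t\in d$. By a triangulation with $\Sigma=\mathrm{Id}$ of an additive category we mean a class of distinguished triangles $X\to Y\to Z\to X$ making it a triangulated category (octahedral axiom included) whose translation functor is the identity functor. Let $\mathcal P$ be the category of projective left $R$-modules and $\mathcal P_{fg}$ the category of finitely generated projective left $R$-modules. (1) $\mathcal P$ admits a triangulation with $\Sigma=\mathrm{Id}$ if and only if one of the following holds, and $\mathcal P_{fg}$ admits a triangulation with $\Sigma=\mathrm{Id}$ if and only if one of the following holds: (i) $R$ is a skew field, i.e. $\mathfrak m=0$;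 (ii) $\mathfrak m=2R$; (iii) $1+1=0$ in $R$, and for some nonzero $x\in\mathfrak m$ there is an element of $d$ that is admissible for $x$. (2) Suppose that $\mathfrak m=2R$ or that $1+1=0$ in $R$. Let $x\in\mathfrak m$ be nonzero, and let $r\in R$ be such that $[r]$ is admissible for $x$. Let $\triangle$ be the triangle $R\to R\to R\to R$ whose three maps are right multiplication by $x$, by $x$ and by $rx$. A triangle is called contractible if consecutive maps compose to zero and its identity morphism is homotopic to zero. Then the triangles isomorphic to a direct sum of contractible triangles and copies of $\triangle$ (respectively, to a finite such direct sum) are the distinguished triangles of a triangulation of $\mathcal P$ (respectively, of $\mathcal P_{fg}$) with $\Sigma=\mathrm{Id}$. (3) If $\mathfrak m=2R\neq 0$, then $2$ is a nonzero element of $\mathfrak m$ and every nonzero central element of $d$ (for example $1$) is admissible for $x=2$; so the construction in (2) applies in case (ii) when $\mathfrak m\ne 0$. -/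

import Mathlib

open CategoryTheory CategoryTheory.Limits CategoryTheory.Pretriangulated

universe u v w

/-! ### Local rings, the residue skew field and the automorphisms `σ_x` -/

namespace LocalTriang

section Rings

variable (R : Type u) [Ring R]

/-- The maximal ideal of a local ring `R`, as the Jacobson radical; see `isMaximal_iff` and
`mem_maxIdeal_iff`: for local `R` it is the unique maximal left ideal, and consists of the
nonunits. -/
abbrev maxIdeal : Ideal R := Ring.jacobson R

variable {R}

theorem isUnit_of_mul_eq_one [IsLocalRing R] {a b : R} (h : a * b = 1) : IsUnit b := by
  have e : b * a + (1 - b * a) = 1 := by abel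
  have hid : b * a * (1 - b * a) = 0 := by
    have h1 : b * a * (b * a) = b * a := by
      rw [mul_assoc, ← mul_assoc a b a, h, one_mul]
    rw [mul_sub, mul_one, h1, sub_self]
  rcases IsLocalRing.isUnit_or_isUnit_of_add_one e with hu | hu
  · have h0 : 1 - b * a = 0 := by
      simpa using (hu.mul_right_eq_zero).1 hid
    exact ⟨⟨b, a, (sub_eq_zero.1 h0).symm, h⟩, rfl⟩
  · have h0 : b * a = 0 := (hu.mul_left_eq_zero).1 hid
    have hb : b = 0 := by
      calc b = b * (a * b) := by rw [h, mul_one]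
        _ = 0 := by rw [← mul_assoc, h0, zero_mul]
    rw [hb, mul_zero] at h
    exact absurd h zero_ne_one

theorem mem_maxIdeal_iff [IsLocalRing R] (a : R) : a ∈ maxIdeal R ↔ ¬ IsUnit a := by
  constructor
  · intro ha hu
    have htop : maxIdeal R = ⊤ := Ideal.eq_top_of_isUnit_mem _ ha hu
    exact (Ring.jacobson_lt_top (R := R)).ne htop
  · intro ha
    rw [maxIdeal, Ring.jacobson_eq_sInf_isMaximal, Submodule.mem_sInf]
    intro I hI
    by_contra hmem
    obtain ⟨y, i, hi, hyi⟩ := (Ideal.IsMaximal.exists_inv (I := I) hI hmem)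
    rcases IsLocalRing.isUnit_or_isUnit_of_add_one hyi with hu | hu
    · obtain ⟨c, hc⟩ := hu.exists_left_inv
      rw [← mul_assoc] at hc
      exact ha (isUnit_of_mul_eq_one hc)
    · exact hI.ne_top (Ideal.eq_top_of_isUnit_mem _ hi hu)

theorem isMaximal_iff [IsLocalRing R] (I : Ideal R) : I.IsMaximal ↔ I = maxIdeal R := by
  have key : ∀ J : Ideal R, J ≠ ⊤ → J ≤ maxIdeal R := fun J hJ a ha =>
    (mem_maxIdeal_iff a).2 fun hu => hJ (Ideal.eq_top_of_isUnit_mem _ ha hu)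
  have hm : maxIdeal R ≠ ⊤ := (Ring.jacobson_lt_top (R := R)).ne
  constructor
  · intro hI
    exact hI.eq_of_le hm (key I hI.ne_top)
  · rintro rfl
    refine Ideal.isMaximal_def.2 ⟨hm, fun J hJ => ?_⟩
    by_contra h
    exact absurd (key J h) (not_le_of_gt hJ)

variable (R)

/-- The residue ring `d = R/𝔪`. -/
abbrev Residue : Type u := R ⧸ maxIdeal R

variable {R}

/-- The residue class `[a] ∈ d` of `a ∈ R`. -/
abbrev res (a : R) : Residue R := Ideal.Quotient.mk (maxIdeal R) a

theorem res_eq_zero_iff {a : R} : res a = 0 ↔ a ∈ maxIdeal R :=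
  Ideal.Quotient.eq_zero_iff_mem

instance residueNontrivial [IsLocalRing R] : Nontrivial (Residue R) :=
  Ideal.Quotient.nontrivial_iff.2 (Ring.jacobson_lt_top (R := R)).ne

/-- The residue ring of a local ring is a skew field. -/
noncomputable instance residueDivisionRing [IsLocalRing R] : DivisionRing (Residue R) :=
  DivisionRing.ofIsUnitOrEqZero fun t => by
    obtain ⟨a, rfl⟩ := Ideal.Quotient.mk_surjective t
    by_cases ha : IsUnit a
    · exact Or.inl (ha.map (Ideal.Quotient.mk (maxIdeal R)))
    · exact Or.inr (res_eq_zero_iff.2 ((mem_maxIdeal_iff a).2 ha))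

variable (R)

/-- The standing conditions on the maximal ideal: `𝔪² = 0` and `𝔪 = Rx = xR` for all nonzero
`x ∈ 𝔪`. -/
structure SquareZeroSimple : Prop where
  sq_zero : ∀ a ∈ maxIdeal R, ∀ b ∈ maxIdeal R, a * b = 0
  eq_left : ∀ x ∈ maxIdeal R, x ≠ 0 → (maxIdeal R : Set R) = Set.range fun a : R => a * x
  eq_right : ∀ x ∈ maxIdeal R, x ≠ 0 → (maxIdeal R : Set R) = Set.range fun a : R => x * a

variable {R}

theorem SquareZeroSimple.exists_left (h : SquareZeroSimple R) {x : R} (hx : x ∈ maxIdeal R)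
    (hx0 : x ≠ 0) (t : R) : ∃ s : R, x * t = s * x := by
  have : x * t ∈ (maxIdeal R : Set R) := by
    rw [h.eq_right x hx hx0]; exact ⟨t, rfl⟩
  rw [h.eq_left x hx hx0] at this
  obtain ⟨s, hs⟩ := this
  exact ⟨s, hs.symm⟩

theorem SquareZeroSimple.exists_right (h : SquareZeroSimple R) {x : R} (hx : x ∈ maxIdeal R)
    (hx0 : x ≠ 0) (s : R) : ∃ t : R, x * t = s * x := by
  have : s * x ∈ (maxIdeal R : Set R) := by
    rw [h.eq_left x hx hx0]; exact ⟨s, rfl⟩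
  rw [h.eq_right x hx hx0] at this
  exact this

theorem res_eq_of_mul_eq [IsLocalRing R] {x : R} (hx0 : x ≠ 0) {s s' : R}
    (e : s * x = s' * x) : res s = res s' := by
  rw [← sub_eq_zero, ← map_sub]
  refine res_eq_zero_iff.2 ((mem_maxIdeal_iff _).2 fun hu => hx0 ?_)
  refine (hu.mul_right_eq_zero).1 ?_
  rw [sub_mul, e, sub_self]

/-- `a ↦ [s]` where `x a = s x`. -/
noncomputable def sigmaAux [IsLocalRing R] (h : SquareZeroSimple R) {x : R}
    (hx : x ∈ maxIdeal R) (hx0 : x ≠ 0) : R →+* Residue R where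
  toFun a := res (h.exists_left hx hx0 a).choose
  map_one' := by
    refine (res_eq_of_mul_eq hx0 (s' := 1) ?_).trans (map_one _)
    rw [← (h.exists_left hx hx0 1).choose_spec, mul_one, one_mul]
  map_zero' := by
    refine (res_eq_of_mul_eq hx0 (s' := 0) ?_).trans (map_zero _)
    rw [← (h.exists_left hx hx0 0).choose_spec, mul_zero, zero_mul]
  map_add' a b := by
    rw [← map_add]
    refine res_eq_of_mul_eq hx0 ?_
    rw [add_mul, ← (h.exists_left hx hx0 (a + b)).choose_spec,
      ← (h.exists_left hx hx0 a).choose_spec, ← (h.exists_left hx hx0 b).choose_spec, mul_add]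
  map_mul' a b := by
    rw [← map_mul]
    refine res_eq_of_mul_eq hx0 ?_
    rw [mul_assoc, ← (h.exists_left hx hx0 (a * b)).choose_spec,
      ← (h.exists_left hx hx0 b).choose_spec, ← mul_assoc _ x b,
      ← (h.exists_left hx hx0 a).choose_spec, mul_assoc]

/-- The ring homomorphism underlying `σ_x`. -/
noncomputable def sigmaHom [IsLocalRing R] (h : SquareZeroSimple R) {x : R}
    (hx : x ∈ maxIdeal R) (hx0 : x ≠ 0) : Residue R →+* Residue R :=
  Ideal.Quotient.lift (maxIdeal R) (sigmaAux h hx hx0) fun a ha => by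
    refine (res_eq_of_mul_eq hx0 (s' := 0) ?_).trans (map_zero _)
    rw [← (h.exists_left hx hx0 a).choose_spec, h.sq_zero x hx a ha, zero_mul]

theorem sigmaHom_res [IsLocalRing R] (h : SquareZeroSimple R) {x : R}
    (hx : x ∈ maxIdeal R) (hx0 : x ≠ 0) {t s : R} (e : x * t = s * x) :
    sigmaHom h hx hx0 (res t) = res s :=
  res_eq_of_mul_eq hx0 ((h.exists_left hx hx0 t).choose_spec.symm.trans e)

/-- The automorphism `σ_x` of the residue skew field `d` attached to a nonzero `x ∈ 𝔪`. It is
characterised by `x t̃ = s̃ x` for any lifts `t̃` of `t` and `s̃` of `σ_x(t)`; see `sigma_res`. -/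
noncomputable def sigma [IsLocalRing R] (h : SquareZeroSimple R) {x : R}
    (hx : x ∈ maxIdeal R) (hx0 : x ≠ 0) : Residue R ≃+* Residue R :=
  RingEquiv.ofBijective (sigmaHom h hx hx0) ⟨(sigmaHom h hx hx0).injective, fun t => by
    obtain ⟨s, rfl⟩ := Ideal.Quotient.mk_surjective t
    obtain ⟨t, ht⟩ := h.exists_right hx hx0 s
    exact ⟨res t, sigmaHom_res h hx hx0 ht⟩⟩

theorem sigma_res [IsLocalRing R] (h : SquareZeroSimple R) {x : R}
    (hx : x ∈ maxIdeal R) (hx0 : x ≠ 0) {t s : R} (e : x * t = s * x) :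
    sigma h hx hx0 (res t) = res s :=
  sigmaHom_res h hx hx0 e

/-- Conditions on a nonzero `r ∈ d` relative to `x`: `σ_x(r) = r`, and
`σ_x³(t) = r⁻¹ t r` for all `t ∈ d`. -/
def IsTwist [IsLocalRing R] (h : SquareZeroSimple R) {x : R}
    (hx : x ∈ maxIdeal R) (hx0 : x ≠ 0) (r : Residue R) : Prop :=
  r ≠ 0 ∧ sigma h hx hx0 r = r ∧
    ∀ t : Residue R, sigma h hx hx0 (sigma h hx hx0 (sigma h hx hx0 t)) = r⁻¹ * t * r

variable (R) in
/-- `𝔪 = 2R`. -/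
def MaxIdealEqTwo : Prop := (maxIdeal R : Set R) = Set.range fun a : R => 2 * a

/-- The semisimple, the mixed-characteristic and the equicharacteristic case. -/
def CaseCondition [IsLocalRing R] (h : SquareZeroSimple R) : Prop :=
  maxIdeal R = ⊥ ∨ MaxIdealEqTwo R ∨
    ((1 : R) + 1 = 0 ∧
      ∃ (x : R) (hx : x ∈ maxIdeal R) (hx0 : x ≠ 0) (r : Residue R), IsTwist h hx hx0 r)

end Rings

/-! ### Triangulations whose translation functor is the identity -/

section Triangulations

variable (C : Type w) [Category.{v} C]

/-- The shift by `ℤ` on `C` all of whose shift functors are the identity functor, with identity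
coherence isomorphisms. -/
@[reducible]
def idShift : HasShift C ℤ :=
  hasShiftMk C ℤ
    { F := fun _ => 𝟭 C
      zero := Iso.refl _
      add := fun _ _ => (Functor.leftUnitor (𝟭 C)).symm
      assoc_hom_app := by intros; simp
      zero_add_hom_app := by intros; simp
      add_zero_hom_app := by intros; simp }

attribute [local instance] idShift

theorem shiftFunctor_idShift (n : ℤ) : shiftFunctor C n = 𝟭 C := rfl

/-- Triangles `X ⟶ Y ⟶ Z ⟶ X` in `C`, for the translation functor `Σ = Id`. -/
abbrev IdTriangle : Type (max w v) := Triangle C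

variable {C}

variable [Preadditive C]

instance idShift_additive (n : ℤ) : (shiftFunctor C n).Additive :=
  inferInstanceAs (𝟭 C).Additive

/-- The class `S` of triangles is (the class of distinguished triangles of) a triangulation of
`C` with `Σ = Id`, the octahedral axiom being included. -/
def IsTriangulation [HasZeroObject C] (S : Set (IdTriangle C)) : Prop :=
  ∃ p : Pretriangulated C, p.distinguishedTriangles = S ∧ IsTriangulated C

variable (C) in
/-- `C` admits a triangulation with `Σ = Id`. -/
def AdmitsTriangulation [HasZeroObject C] : Prop :=
  ∃ S : Set (IdTriangle C), IsTriangulation S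

/-- A triangle (consecutive composites vanish) whose identity is homotopic to zero. -/
def IsContractible (T : IdTriangle C) : Prop :=
  T.mor₁ ≫ T.mor₂ = 0 ∧ T.mor₂ ≫ T.mor₃ = 0 ∧ T.mor₃ ≫ T.mor₁⟦(1 : ℤ)⟧' = 0 ∧
    ∃ (Θ : T.obj₂ ⟶ T.obj₁) (Φ : T.obj₃ ⟶ T.obj₂) (Ψ : T.obj₁⟦(1 : ℤ)⟧ ⟶ T.obj₃),
      𝟙 T.obj₂ = T.mor₂ ≫ Φ + Θ ≫ T.mor₁ ∧
      𝟙 T.obj₃ = T.mor₃ ≫ Ψ + Φ ≫ T.mor₂ ∧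
      𝟙 (T.obj₁⟦(1 : ℤ)⟧) = (T.mor₁ ≫ Θ)⟦(1 : ℤ)⟧' + Ψ ≫ T.mor₃

/-- `T` is isomorphic to a direct sum (coproduct of triangles), indexed by `ι`, of triangles each
of which is contractible or equal to `D`. -/
def IsSumOfContractibleOr (D : IdTriangle C) (ι : Type u) (T : IdTriangle C) : Prop :=
  ∃ (F : ι → IdTriangle C) (c : Cofan F),
    (∀ i, IsContractible (F i) ∨ F i = D) ∧ Nonempty (IsColimit c) ∧ Nonempty (T ≅ c.pt)

end Triangulations

/-! ### The categories of projective and of finitely generated projective modules -/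

section Modules

variable (R : Type u) [Ring R]

/-- Projective left `R`-modules. -/
def isProj : ObjectProperty (ModuleCat.{u} R) := fun M => Module.Projective R M

/-- Finitely generated projective left `R`-modules. -/
def isFGProj : ObjectProperty (ModuleCat.{u} R) :=
  fun M => Module.Projective R M ∧ Module.Finite R M

instance : (isProj R).ContainsZero where
  exists_zero := ⟨ModuleCat.of R PUnit.{u + 1}, ModuleCat.isZero_of_subsingleton _,
    (inferInstance : Module.Projective R PUnit.{u + 1})⟩

instance : (isFGProj R).ContainsZero where
  exists_zero := ⟨ModuleCat.of R PUnit.{u + 1}, ModuleCat.isZero_of_subsingleton _,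
    (inferInstance : Module.Projective R PUnit.{u + 1}), (inferInstance : Module.Finite R PUnit.{u + 1})⟩

/-- The category of projective left `R`-modules. -/
abbrev ProjCat : Type (u + 1) := (isProj R).FullSubcategory

/-- The category of finitely generated projective left `R`-modules. -/
abbrev FGProjCat : Type (u + 1) := (isFGProj R).FullSubcategory

theorem isProj_self : isProj R (ModuleCat.of R R) := (inferInstance : Module.Projective R R)

theorem isFGProj_self : isFGProj R (ModuleCat.of R R) :=
  ⟨(inferInstance : Module.Projective R R), (inferInstance : Module.Finite R R)⟩

variable {R}

/-- Right multiplication `y ↦ y a` as an endomorphism of the left module `R` in a full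
subcategory of modules that contains it. -/
def mulRightHom {P : ObjectProperty (ModuleCat.{u} R)} (hP : P (ModuleCat.of R R)) (a : R) :
    (⟨ModuleCat.of R R, hP⟩ : P.FullSubcategory) ⟶ ⟨ModuleCat.of R R, hP⟩ :=
  ObjectProperty.homMk (ModuleCat.ofHom (LinearMap.toSpanSingleton R R a))

theorem mulRightHom_apply {P : ObjectProperty (ModuleCat.{u} R)} (hP : P (ModuleCat.of R R))
    (a y : R) : (mulRightHom hP a).hom y = y * a := rfl

attribute [local instance] idShift in
/-- The triangle `R ⟶ R ⟶ R ⟶ R` given by right multiplication by `x`, `x` and `r x`. -/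
def deltaTriangle {P : ObjectProperty (ModuleCat.{u} R)} (hP : P (ModuleCat.of R R)) (x r : R) :
    IdTriangle P.FullSubcategory :=
  Triangle.mk (mulRightHom hP x) (mulRightHom hP x) (mulRightHom hP (r * x))

/-- Triangles of projective modules isomorphic to a direct sum of contractible triangles and
copies of the triangle given by `x`, `x` and `r x`. -/
def projTriangles (x r : R) : Set (IdTriangle (ProjCat R)) :=
  {T | ∃ ι : Type u, IsSumOfContractibleOr (deltaTriangle (isProj_self R) x r) ι T}

/-- Triangles of finitely generated projective modules isomorphic to a finite direct sum of
contractible triangles and copies of the triangle given by `x`, `x` and `r x`. -/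
def fgProjTriangles (x r : R) : Set (IdTriangle (FGProjCat R)) :=
  {T | ∃ ι : Type u, Finite ι ∧
    IsSumOfContractibleOr (deltaTriangle (isFGProj_self R) x r) ι T}

end Modules

end LocalTriang

/-! Sufficiency rests on an intrinsic description of the distinguished triangles. Given `x` and `r`
as in `Setup`, the predicate `ETri` asks that `X → Y → Z → X` be exact at all three places and
satisfy a Bockstein-type condition: whenever `f v = x y`, some `z` has `g y = x z` and `h z = x r
v`. For `x = 0` only exactness remains, which settles the skew field case with the same argument.
The condition is invariant under isomorphism and direct sums, and it holds for contractible
triangles and for the triangle of the theorem; for the latter it amounts to `σ³(t) = r⁻¹ t r`.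

Conversely, projective modules are free by a Nakayama argument, and any linear map is, in suitable
bases, a sum of identities, multiplications by `x` and zero maps (`Setup.exists_mapNF`). Such a map
has an obvious cone (`MapNF.exists_triNF`). The Bockstein condition produces a comparison from this
cone to any `ETri` triangle on the same map, and it is bijective by a five-lemma chase. So `ETri`
triangles are exactly the direct sums in the theorem (`Setup.exists_triNF`), and the morphism axiom
follows by defining the fill-in on a basis. Since `2x = 0`, signs never matter.

The octahedral axiom is reduced to `Setup.exists_coneMap`, which treats `X → X × W → Y`. There
exactness is formal, but the fill-in has to be chosen well for the Bockstein condition. A normal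
form of `X → Y` adapted to the map `W → Y` makes this choice possible. Two applications give the
general octahedron.

For necessity, take a cone of right multiplication by a nonzero `x ∈ 𝔪`. It is free of rank one
(`SquareZeroSimple.bijective_toSpanSingleton`), so the triangle becomes `x`, `ρx`, `x`. Lifting
morphisms from it to its rotation gives a twisted formula for `σ³`; its values at `1` and `ρ` force
`-ρ = ρ = σ(ρ)`. Hence `2 ∈ 𝔪` and `[ρ]` is admissible. Either `2 = 0`, or `2` generates `𝔪`. -/

namespace LocalTriang

/-! ### Residual bases and freeness of projective modules -/

section Residual

variable {R : Type u} [Ring R]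

/-- A generator `x` of the maximal ideal (on both sides) together with a unit `r` such that
`x` and `r` define a triangulation. For a skew field this allows `x = 0`. -/
structure Setup (x r : R) : Prop where
  mem : x ∈ maxIdeal R
  left : ∀ a ∈ maxIdeal R, ∃ c, a = c * x
  right : ∀ a ∈ maxIdeal R, ∃ c, a = x * c
  sq : ∀ a ∈ maxIdeal R, ∀ b ∈ maxIdeal R, a * b = 0
  ann : x ≠ 0 → ∀ c, x * c = 0 → c ∈ maxIdeal R
  comm : x * r = r * x
  unit : IsUnit r
  add_self : x + x = 0
  -- The relation `σ³(t) = r⁻¹ t r` for `t = [c₃]`, where `σ³(t) = [c]`, written without division so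
  -- that it also makes sense for `x = 0`.
  cube : ∀ c c₁ c₂ c₃, c * x = x * c₁ → c₁ * x = x * c₂ → c₂ * x = x * c₃ →
    x * (c₃ * r) = x * (r * c)

namespace Setup

variable {x r : R} (S : Setup x r)
include S

theorem exists_right (c : R) : ∃ c', c * x = x * c' :=
  S.right _ (Ideal.mul_mem_left _ c S.mem)

theorem exists_left (c : R) : ∃ c', x * c = c' * x :=
  S.left _ (Ideal.mul_mem_right c _ S.mem)

theorem mul_self : x * x = 0 := S.sq x S.mem x S.mem

theorem neg_eq : -x = x := neg_eq_of_add_eq_zero_left S.add_self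

variable {M : Type u} [AddCommGroup M] [Module R M]

theorem smul_smul_self (y : M) : x • x • y = 0 := by
  rw [smul_smul, S.mul_self, zero_smul]

theorem neg_smul_eq (y : M) : -(x • y) = x • y := by
  rw [← neg_smul, S.neg_eq]

variable (M) in
/-- The submodule `x M = 𝔪 M`. -/
def rad : Submodule R M where
  carrier := {y | ∃ y', x • y' = y}
  zero_mem' := ⟨0, smul_zero _⟩
  add_mem' := by
    rintro _ _ ⟨a, rfl⟩ ⟨b, rfl⟩
    exact ⟨a + b, smul_add _ _ _⟩
  smul_mem' := by
    rintro c _ ⟨a, rfl⟩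
    obtain ⟨c', hc⟩ := S.exists_right c
    exact ⟨c' • a, by rw [smul_smul, smul_smul, hc]⟩

theorem smul_mem_rad (y : M) : x • y ∈ S.rad M := ⟨y, rfl⟩

theorem smul_mem_rad_of_mem {a : R} (ha : a ∈ maxIdeal R) (y : M) : a • y ∈ S.rad M := by
  obtain ⟨c, rfl⟩ := S.right a ha
  exact ⟨c • y, by rw [smul_smul]⟩

theorem smul_eq_zero_of_mem_rad {y : M} (hy : y ∈ S.rad M) : x • y = 0 := by
  obtain ⟨y', rfl⟩ := hy
  exact S.smul_smul_self y'

/-- The choice of `c'` in `x c = c' x` is normalised at `0` so that it can be applied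
coefficientwise to finitely supported functions. -/
theorem exists_moveLeft : ∃ k : R → R, k 0 = 0 ∧ ∀ c, x * c = k c * x := by
  classical
  choose k hk using S.exists_left
  refine ⟨fun c => if c = 0 then 0 else k c, by simp, fun c => ?_⟩
  by_cases h : c = 0
  · simp [h]
  · simp [h, hk]

theorem exists_factor : ∃ k : R → R, k 0 = 0 ∧ ∀ c ∈ maxIdeal R, c = x * k c := by
  classical
  choose! k hk using S.right
  refine ⟨fun c => if c = 0 then 0 else k c, by simp, fun c hc => ?_⟩
  by_cases h : c = 0
  · simp [h]
  · simpa [h] using hk c hc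

end Setup

variable {M : Type u} [AddCommGroup M] [Module R M]

/-- A family in `N₂` that becomes a basis of `N₂ / N₁` over the residue skew field. -/
structure RelBasis (N₁ N₂ : Submodule R M) {ι : Type u} (e : ι → M) : Prop where
  mem : ∀ i, e i ∈ N₂
  span : ∀ n ∈ N₂, ∃ c : ι →₀ R, n - Finsupp.linearCombination R e c ∈ N₁
  indep : ∀ c : ι →₀ R, Finsupp.linearCombination R e c ∈ N₁ → ∀ i, c i ∈ maxIdeal R

/-- The quotient `N₂ / N₁` is killed by `𝔪`, so it is a vector space over the residue skew field; a
basis of it is lifted to `N₂`. -/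
theorem exists_relBasis [IsLocalRing R] {N₁ N₂ : Submodule R M}
    (h : ∀ a ∈ maxIdeal R, ∀ n ∈ N₂, a • n ∈ N₁) :
    ∃ (ι : Type u) (e : ι → M), RelBasis N₁ N₂ e := by
  let Q := N₂ ⧸ N₁.comap N₂.subtype
  have ht : Module.IsTorsionBySet R Q (maxIdeal R) := by
    rintro q ⟨a, ha⟩
    obtain ⟨n, rfl⟩ := Submodule.mkQ_surjective _ q
    change a • Submodule.Quotient.mk n = _
    rw [← Submodule.Quotient.mk_smul, Submodule.Quotient.mk_eq_zero]
    exact h a ha n n.2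
  let : Module (Residue R) Q := ht.module
  have hs : ∀ (a : R) (q : Q), res a • q = a • q := fun a q => ht.mk_smul a q
  let b := Module.Basis.ofVectorSpace (Residue R) Q
  choose e he using fun i => Submodule.mkQ_surjective (N₁.comap N₂.subtype) (b i)
  have key : ∀ c : Module.Basis.ofVectorSpaceIndex (Residue R) Q →₀ R,
      Submodule.mkQ (N₁.comap N₂.subtype) (Finsupp.linearCombination R e c) =
        Finsupp.linearCombination (Residue R) b (c.mapRange res (map_zero _)) := by
    intro c
    rw [Finsupp.linearCombination_apply, Finsupp.linearCombination_apply,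
      Finsupp.sum_mapRange_index (by simp), map_finsuppSum]
    refine Finsupp.sum_congr fun i _ => ?_
    rw [map_smul, he, hs]
  have hcoe : ∀ c : Module.Basis.ofVectorSpaceIndex (Residue R) Q →₀ R,
      ((Finsupp.linearCombination R e c : N₂) : M) =
        Finsupp.linearCombination R (fun i => (e i : M)) c := by
    intro c
    rw [← Submodule.subtype_apply, Finsupp.linearCombination_apply, map_finsuppSum,
      Finsupp.linearCombination_apply]
    rfl
  refine ⟨_, fun i => (e i : M), fun i => (e i).2, fun n hn => ?_, fun c hc i => ?_⟩
  · have hsurj : Function.Surjective (res : R → Residue R) := Ideal.Quotient.mk_surjective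
    obtain ⟨c, hc⟩ := Finsupp.mapRange_surjective res (map_zero _) hsurj
      (b.repr (Submodule.mkQ _ ⟨n, hn⟩))
    refine ⟨c, ?_⟩
    have h1 := key c
    rw [hc, b.linearCombination_repr] at h1
    have h2 := (Submodule.Quotient.eq _).1 h1.symm
    simpa [hcoe] using h2
  · have h1 : Submodule.mkQ (N₁.comap N₂.subtype) (Finsupp.linearCombination R e c) = 0 := by
      rw [Submodule.mkQ_apply, Submodule.Quotient.mk_eq_zero]
      simpa [hcoe] using hc
    rw [key] at h1
    have h2 := linearIndependent_iff.1 b.linearIndependent _ h1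
    have h3 := DFunLike.congr_fun h2 i
    rw [Finsupp.mapRange_apply] at h3
    exact res_eq_zero_iff.1 h3

theorem linearCombination_sumElim {ι κ : Type u} (e : ι → M) (e' : κ → M) (c : κ ⊕ ι →₀ R) :
    Finsupp.linearCombination R (Sum.elim e' e) c =
      Finsupp.linearCombination R e' (Finsupp.sumFinsuppEquivProdFinsupp c).1 +
      Finsupp.linearCombination R e (Finsupp.sumFinsuppEquivProdFinsupp c).2 := by
  have h : Finsupp.linearCombination R (Sum.elim e' e) =
      (Finsupp.linearCombination R e').coprod (Finsupp.linearCombination R e) ∘ₗ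
        (Finsupp.sumFinsuppLEquivProdFinsupp R).toLinearMap := by
    refine Finsupp.lhom_ext' fun i => LinearMap.ext_ring ?_
    have h1 : ∀ i : κ, Finsupp.sumFinsuppLEquivProdFinsupp R
        (Finsupp.single (Sum.inl i : κ ⊕ ι) (1 : R)) = (Finsupp.single i 1, 0) := by
      intro i
      classical
      refine Prod.ext (Finsupp.ext fun j => ?_) (Finsupp.ext fun j => ?_)
      · simp [Finsupp.single_apply]
      · simp
    have h2 : ∀ i : ι, Finsupp.sumFinsuppLEquivProdFinsupp R
        (Finsupp.single (Sum.inr i : κ ⊕ ι) (1 : R)) = (0, Finsupp.single i 1) := by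
      intro i
      classical
      refine Prod.ext (Finsupp.ext fun j => ?_) (Finsupp.ext fun j => ?_)
      · simp
      · simp [Finsupp.single_apply]
    rcases i with i | i
    · simp [h1]
    · simp [h2]
  exact LinearMap.congr_fun h c

theorem smul_linearCombination {ι : Type u} {x : R} {e : ι → M} {k : R → R} (hk0 : k 0 = 0)
    (hk : ∀ c, x * c = k c * x) (c : ι →₀ R) :
    x • Finsupp.linearCombination R e c =
      Finsupp.linearCombination R (fun i => x • e i) (c.mapRange k hk0) := by
  rw [Finsupp.linearCombination_apply, Finsupp.linearCombination_apply,
    Finsupp.sum_mapRange_index (by simp), Finsupp.smul_sum]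
  exact Finsupp.sum_congr fun i _ => by rw [smul_smul, smul_smul, hk]

namespace RelBasis

variable {N₁ N₂ N₃ : Submodule R M} {ι κ : Type u} {e : ι → M} {e' : κ → M}

theorem congr (h : RelBasis N₁ N₂ e) (h12 : N₁ ≤ N₂) {f : ι → M} (hf : ∀ i, e i - f i ∈ N₁) :
    RelBasis N₁ N₂ f := by
  have key : ∀ c : ι →₀ R, Finsupp.linearCombination R e c -
      Finsupp.linearCombination R f c ∈ N₁ := by
    intro c
    rw [Finsupp.linearCombination_apply, Finsupp.linearCombination_apply, Finsupp.sum,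
      Finsupp.sum, ← Finset.sum_sub_distrib]
    refine Submodule.sum_mem _ fun i _ => ?_
    rw [← smul_sub]
    exact N₁.smul_mem _ (hf i)
  refine ⟨fun i => ?_, fun n hn => ?_, fun c hc => h.indep c ?_⟩
  · rw [← sub_sub_self (e i) (f i)]
    exact N₂.sub_mem (h.mem i) (h12 (hf i))
  · obtain ⟨c, hc⟩ := h.span n hn
    refine ⟨c, ?_⟩
    rw [← sub_add_sub_cancel n (Finsupp.linearCombination R e c)]
    exact N₁.add_mem hc (key c)
  · rw [← sub_add_cancel (Finsupp.linearCombination R e c) (Finsupp.linearCombination R f c)]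
    exact N₁.add_mem (key c) hc

theorem reindex (h : RelBasis N₁ N₂ e) (σ : κ ≃ ι) : RelBasis N₁ N₂ (e ∘ σ) := by
  have key : ∀ c : κ →₀ R, Finsupp.linearCombination R (e ∘ σ) c =
      Finsupp.linearCombination R e (c.mapDomain σ) := fun c =>
    (Finsupp.linearCombination_mapDomain R σ c).symm
  refine ⟨fun i => h.mem _, fun n hn => ?_, fun c hc i => ?_⟩
  · obtain ⟨c, hc⟩ := h.span n hn
    refine ⟨c.mapDomain σ.symm, ?_⟩
    rw [key, ← Finsupp.mapDomain_comp]
    simpa [Finsupp.mapDomain_id] using hc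
  · rw [key] at hc
    have := h.indep _ hc (σ i)
    rwa [Finsupp.mapDomain_apply σ.injective] at this

/-- Bases of the successive quotients of a filtration combine. The hypothesis `hm` is needed for
independence: once the coefficients on the upper layer lie in `𝔪`, their combination already lies in
`N₁` and can be subtracted. -/
theorem sum (h : RelBasis N₁ N₂ e) (h' : RelBasis N₂ N₃ e') (h12 : N₁ ≤ N₂) (h23 : N₂ ≤ N₃)
    (hm : ∀ a ∈ maxIdeal R, ∀ n ∈ N₃, a • n ∈ N₁) :
    RelBasis N₁ N₃ (Sum.elim e' e) := by
  have hlc : ∀ c : ι →₀ R, Finsupp.linearCombination R e c ∈ N₂ := fun c =>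
    Submodule.sum_mem _ fun i _ => N₂.smul_mem _ (h.mem i)
  have key := linearCombination_sumElim (R := R) e e'
  refine ⟨?_, fun n hn => ?_, fun c hc => ?_⟩
  · rintro (i | i)
    · exact h'.mem i
    · exact h23 (h.mem i)
  · obtain ⟨c', hc'⟩ := h'.span n hn
    obtain ⟨c, hc⟩ := h.span _ hc'
    refine ⟨Finsupp.sumFinsuppEquivProdFinsupp.symm (c', c), ?_⟩
    rw [key, Equiv.apply_symm_apply, ← sub_sub]
    exact hc
  · rw [key] at hc
    set c₁ := (Finsupp.sumFinsuppEquivProdFinsupp c).1 with hc1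
    set c₂ := (Finsupp.sumFinsuppEquivProdFinsupp c).2 with hc2
    have h1 : ∀ i, c₁ i ∈ maxIdeal R := by
      refine h'.indep c₁ ?_
      have := N₂.sub_mem (h12 hc) (hlc c₂)
      rwa [add_sub_cancel_right] at this
    have h2 : Finsupp.linearCombination R e' c₁ ∈ N₁ :=
      Submodule.sum_mem _ fun i _ => hm _ (h1 i) _ (h'.mem i)
    have h3 : ∀ i, c₂ i ∈ maxIdeal R := by
      refine h.indep c₂ ?_
      have := N₁.sub_mem hc h2
      rwa [add_sub_cancel_left] at this
    rintro (i | i)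
    · exact h1 i
    · exact h3 i

end RelBasis

namespace Setup

variable {x r : R} (S : Setup x r) {ι : Type u}
include S

theorem exists_eq_smul_of_coeff_mem (c : ι →₀ R) (hc : ∀ i, c i ∈ maxIdeal R) :
    ∃ c' : ι →₀ R, c = x • c' := by
  obtain ⟨k, hk0, hk⟩ := S.exists_factor
  refine ⟨c.mapRange k hk0, ?_⟩
  ext i
  simpa using hk _ (hc i)

/-- Nakayama's lemma with `x² = 0`. Approximating twice modulo `x M` gives surjectivity. By
projectivity the surjection splits, and its kernel lies in `x` times the free module; applying this
inclusion twice, the second time to `c' - s (…)`, shows that the kernel is zero. -/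
theorem bijective_of_relBasis [Module.Projective R M] {e : ι → M}
    (h : RelBasis (S.rad M) ⊤ e) : Function.Bijective (Finsupp.linearCombination R e) := by
  have hsurj : Function.Surjective (Finsupp.linearCombination R e) := by
    intro n
    obtain ⟨c, y, hy⟩ := h.span n trivial
    obtain ⟨c', y', hy'⟩ := h.span y trivial
    refine ⟨c + x • c', ?_⟩
    have h1 : y = x • y' + Finsupp.linearCombination R e c' := sub_eq_iff_eq_add.1 hy'.symm
    rw [h1, smul_add, S.smul_smul_self, zero_add] at hy
    rw [map_add, map_smul, hy]
    abel
  refine ⟨?_, hsurj⟩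
  obtain ⟨s, hs⟩ := Module.projective_lifting_property _ LinearMap.id hsurj
  have hs' : ∀ m, Finsupp.linearCombination R e (s m) = m := fun m => LinearMap.congr_fun hs m
  have hker : ∀ c, Finsupp.linearCombination R e c = 0 → ∃ c', c = x • c' := fun c hc =>
    S.exists_eq_smul_of_coeff_mem c (h.indep c (hc ▸ zero_mem _))
  rw [← LinearMap.ker_eq_bot, LinearMap.ker_eq_bot']
  intro c hc
  obtain ⟨c', rfl⟩ := hker c hc
  have h0 : Finsupp.linearCombination R e
      (c' - s (Finsupp.linearCombination R e c')) = 0 := by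
    rw [map_sub, hs', sub_self]
  obtain ⟨c'', h1⟩ := hker _ h0
  have h2 : x • s (Finsupp.linearCombination R e c') = 0 := by
    rw [← map_smul, ← map_smul, hc, map_zero]
  have h3 : x • c' = x • (c' - s (Finsupp.linearCombination R e c')) := by
    rw [smul_sub, h2, sub_zero]
  rw [h3, h1, S.smul_smul_self]

/-- A residual basis of a projective module is a basis. -/
theorem exists_basis_of_relBasis [Module.Projective R M] {e : ι → M}
    (h : RelBasis (S.rad M) ⊤ e) : ∃ b : Module.Basis ι R M, ∀ i, b i = e i := by
  refine ⟨⟨(LinearEquiv.ofBijective _ (S.bijective_of_relBasis h)).symm⟩, fun i => ?_⟩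
  change LinearEquiv.ofBijective _ (S.bijective_of_relBasis h) (Finsupp.single i 1) = e i
  simp

theorem exists_basis [IsLocalRing R] [Module.Projective R M] :
    ∃ ι : Type u, Nonempty (Module.Basis ι R M) := by
  obtain ⟨ι, e, h⟩ := exists_relBasis (R := R) (N₁ := S.rad M) (N₂ := ⊤)
    fun a ha n _ => S.smul_mem_rad_of_mem ha n
  obtain ⟨b, -⟩ := S.exists_basis_of_relBasis h
  exact ⟨ι, ⟨b⟩⟩

/-- In a free module this can be checked on coordinates, where the right annihilator of `x` is `𝔪 =
xR`. It serves to correct elements that agree after multiplication by `x`. -/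
theorem mem_rad_of_smul_eq_zero [IsLocalRing R] [Module.Projective R M] (hx : x ≠ 0) {y : M}
    (hy : x • y = 0) : ∃ y', y = x • y' := by
  obtain ⟨ι, ⟨b⟩⟩ := S.exists_basis (M := M)
  obtain ⟨c, hc⟩ := S.exists_eq_smul_of_coeff_mem (b.repr y) fun i => S.ann hx _ (by
    have := DFunLike.congr_fun (congrArg b.repr hy) i
    simpa using this)
  refine ⟨b.repr.symm c, ?_⟩
  rw [← map_smul, ← hc, LinearEquiv.symm_apply_apply]

end Setup

end Residual

/-! ### Normal forms of linear maps -/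

section NormalForm

variable {R : Type u} [Ring R]
variable {X Y Z W : Type u} [AddCommGroup X] [Module R X] [AddCommGroup Y] [Module R Y]
  [AddCommGroup Z] [Module R Z] [AddCommGroup W] [Module R W]

/-- Bases in which `f` is a direct sum of identities, multiplications by `x` and zero maps. -/
structure MapNF (x : R) {A B C K : Type u} (bX : Module.Basis (A ⊕ B ⊕ K) R X)
    (bY : Module.Basis (A ⊕ B ⊕ C) R Y) (f : X →ₗ[R] Y) : Prop where
  ne : B → x ≠ 0
  fa : ∀ a, f (bX (Sum.inl a)) = bY (Sum.inl a)
  fb : ∀ b, f (bX (Sum.inr (Sum.inl b))) = x • bY (Sum.inr (Sum.inl b))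
  fk : ∀ k, f (bX (Sum.inr (Sum.inr k))) = 0

/-- Bases in which the triangle given by `f`, `g`, `h` is a direct sum of contractible triangles
and of copies of the triangle given by `x`, `x`, `x r`. -/
structure TriNF (x r : R) {A B C K : Type u} (bX : Module.Basis (A ⊕ B ⊕ K) R X)
    (bY : Module.Basis (A ⊕ B ⊕ C) R Y) (bZ : Module.Basis (B ⊕ C ⊕ K) R Z)
    (f : X →ₗ[R] Y) (g : Y →ₗ[R] Z) (h : Z →ₗ[R] X) : Prop extends MapNF x bX bY f where
  ga : ∀ a, g (bY (Sum.inl a)) = 0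
  gb : ∀ b, g (bY (Sum.inr (Sum.inl b))) = x • bZ (Sum.inl b)
  gc : ∀ c, g (bY (Sum.inr (Sum.inr c))) = bZ (Sum.inr (Sum.inl c))
  hb : ∀ b, h (bZ (Sum.inl b)) = (x * r) • bX (Sum.inr (Sum.inl b))
  hc : ∀ c, h (bZ (Sum.inr (Sum.inl c))) = 0
  hk : ∀ k, h (bZ (Sum.inr (Sum.inr k))) = bX (Sum.inr (Sum.inr k))

namespace Setup

variable {x r : R} (S : Setup x r)
include S

/-- The submodule `x N`. -/
def smulSub (N : Submodule R Y) : Submodule R Y where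
  carrier := {y | ∃ y' ∈ N, x • y' = y}
  zero_mem' := ⟨0, N.zero_mem, smul_zero _⟩
  add_mem' := by
    rintro _ _ ⟨a, ha, rfl⟩ ⟨b, hb, rfl⟩
    exact ⟨a + b, N.add_mem ha hb, smul_add _ _ _⟩
  smul_mem' := by
    rintro c _ ⟨a, ha, rfl⟩
    obtain ⟨c', hc⟩ := S.exists_right c
    exact ⟨c' • a, N.smul_mem _ ha, by rw [smul_smul, smul_smul, hc]⟩

theorem smulSub_mono {N N' : Submodule R Y} (h : N ≤ N') : S.smulSub N ≤ S.smulSub N' := by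
  rintro _ ⟨a, ha, rfl⟩
  exact ⟨a, h ha, rfl⟩

variable [IsLocalRing R]

/-- Every map has a normal form, which can be chosen compatibly with a second map `q` into the
same module. -/
theorem exists_mapNF [Module.Projective R X] [Module.Projective R Y] (f : X →ₗ[R] Y)
    (q : W →ₗ[R] Y) :
    ∃ (A B C K : Type u) (bX : Module.Basis (A ⊕ B ⊕ K) R X) (bY : Module.Basis (A ⊕ B ⊕ C) R Y)
      (s : Set B), MapNF x bX bY f ∧
      (∀ b ∈ s, ∃ w ξ, bY (Sum.inr (Sum.inl b)) = q w + f ξ) ∧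
      ∀ w ξ (c : B →₀ R) y,
        q w = f ξ + Finsupp.linearCombination R (fun b => bY (Sum.inr (Sum.inl b))) c + x • y →
        ∀ b ∉ s, c b ∈ maxIdeal R := by
  -- The bases come from the filtration `rad X ≤ K' ≤ N'' ≤ N' ≤ X` by the divisibility of `f v` by
  -- `x`: in the image of `f`, in the sum of the images of `q` and `f`, or in `Y`. Its layers are
  -- indexed by `K`, `B₁`, `B₂` and `A`.
  let K' := (S.smulSub (LinearMap.range f)).comap f
  let N'' := (S.smulSub (LinearMap.range q ⊔ LinearMap.range f)).comap f
  let N' := (S.smulSub ⊤).comap f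
  have hK : S.rad X ≤ K' := by
    rintro _ ⟨v, rfl⟩
    exact ⟨f v, ⟨v, rfl⟩, (map_smul _ _ _).symm⟩
  have hKN : K' ≤ N'' := Submodule.comap_mono (S.smulSub_mono le_sup_right)
  have hNN : N'' ≤ N' := Submodule.comap_mono (S.smulSub_mono le_top)
  have htor : ∀ N : Submodule R X, S.rad X ≤ N → ∀ N₂ : Submodule R X,
      ∀ a ∈ maxIdeal R, ∀ n ∈ N₂, a • n ∈ N := fun N hN _ a ha n _ =>
    hN (S.smul_mem_rad_of_mem ha n)
  obtain ⟨K, ek', hek'⟩ := exists_relBasis (htor _ le_rfl K')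
  obtain ⟨B₁, e₁, he₁⟩ := exists_relBasis (htor _ hK N'')
  obtain ⟨B₂, e₂, he₂⟩ := exists_relBasis (htor _ (hK.trans hKN) N')
  obtain ⟨A, ea, hea⟩ := exists_relBasis (htor _ ((hK.trans hKN).trans hNN) ⊤)
  have hk : ∀ k, ∃ ξ, x • f ξ = f (ek' k) := by
    intro k
    obtain ⟨_, ⟨ξ, rfl⟩, h⟩ := hek'.mem k
    exact ⟨ξ, h⟩
  choose ξk hξk using hk
  -- As `f (ek' k) = x f (ξk k)`, this change modulo `x X` moves the vector into the kernel of `f`.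
  let ek : K → X := fun k => ek' k - x • ξk k
  have hek : RelBasis (S.rad X) K' ek := hek'.congr hK fun k => by
    simp only [ek, sub_sub_cancel]
    exact S.smul_mem_rad _
  have hb₁ : ∀ b, ∃ w ξ, x • (q w + f ξ) = f (e₁ b) := by
    intro b
    obtain ⟨y, hy, h⟩ := he₁.mem b
    obtain ⟨_, ⟨w, rfl⟩, _, ⟨ξ, rfl⟩, rfl⟩ := Submodule.mem_sup.1 hy
    exact ⟨w, ξ, h⟩
  choose w₁ ξ₁ hw₁ using hb₁
  have hb₂ : ∀ b, ∃ y, x • y = f (e₂ b) := by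
    intro b
    obtain ⟨y, -, h⟩ := he₂.mem b
    exact ⟨y, h⟩
  choose y₂ hy₂ using hb₂
  let B := B₂ ⊕ B₁
  let eb : B → X := Sum.elim e₂ e₁
  let yb : B → Y := Sum.elim y₂ fun b => q (w₁ b) + f (ξ₁ b)
  have hyb : ∀ b, x • yb b = f (eb b) := by
    rintro (b | b)
    · exact hy₂ b
    · exact hw₁ b
  have heb : RelBasis K' N' eb := he₁.sum he₂ hKN hNN (htor _ hK _)
  have hX : RelBasis (S.rad X) ⊤ (Sum.elim ea (Sum.elim eb ek)) :=
    (hek.sum heb hK (hKN.trans hNN) (htor _ le_rfl _)).sum hea (hK.trans (hKN.trans hNN)) le_top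
      (htor _ le_rfl _)
  have hx : B → x ≠ 0 := by
    rintro b rfl
    have h1 : Finsupp.linearCombination R eb (Finsupp.single b 1) ∈ K' := by
      rw [Finsupp.linearCombination_single, one_smul]
      refine ⟨0, zero_mem _, ?_⟩
      rw [← hyb, zero_smul, zero_smul]
    have h2 := heb.indep _ h1 b
    rw [Finsupp.single_eq_same, mem_maxIdeal_iff] at h2
    exact h2 isUnit_one
  obtain ⟨k, hk0, hk⟩ := S.exists_moveLeft
  have hxlc : ∀ c : B →₀ R, x • Finsupp.linearCombination R yb c =
      f (Finsupp.linearCombination R eb (c.mapRange k hk0)) := by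
    intro c
    rw [smul_linearCombination hk0 hk, Finsupp.apply_linearCombination]
    simp only [hyb]
    rfl
  have hkm : ∀ c, x ≠ 0 → k c ∈ maxIdeal R → c ∈ maxIdeal R := by
    intro c hx0 hc
    exact S.ann hx0 _ (by rw [hk, S.sq _ hc _ S.mem])
  -- The vectors `f (ea a)` and `yb b` are independent modulo `x Y`. Multiplying a relation by `x`
  -- kills it and puts the combination of the `eb` in `K'`, so the `yb` coefficients lie in `𝔪`; the
  -- rest of the relation then contradicts independence of the `ea` modulo `N'` unless those
  -- coefficients lie in `𝔪` too.
  let Y₂ := S.rad Y ⊔ Submodule.span R (Set.range (Sum.elim (f ∘ ea) yb))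
  have hY₂ : RelBasis (S.rad Y) Y₂ (Sum.elim (f ∘ ea) yb) := by
    refine ⟨fun i => Submodule.mem_sup_right (Submodule.subset_span ⟨i, rfl⟩), fun n hn => ?_,
      fun c hc => ?_⟩
    · obtain ⟨y, hy, z, hz, rfl⟩ := Submodule.mem_sup.1 hn
      obtain ⟨c, rfl⟩ := (Finsupp.mem_span_range_iff_exists_finsupp).1 hz
      exact ⟨c, by rw [Finsupp.linearCombination_apply, add_sub_cancel_right]; exact hy⟩
    · rw [linearCombination_sumElim] at hc
      set c₁ := (Finsupp.sumFinsuppEquivProdFinsupp c).1 with hc1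
      set c₂ := (Finsupp.sumFinsuppEquivProdFinsupp c).2 with hc2
      have h0 := S.smul_eq_zero_of_mem_rad hc
      rw [smul_add, hxlc, ← Finsupp.apply_linearCombination] at h0
      have h1 := heb.indep (c₂.mapRange k hk0) ⟨-f (Finsupp.linearCombination R ea c₁),
        neg_mem ⟨_, rfl⟩, by rw [smul_neg]; exact neg_eq_of_add_eq_zero_right h0⟩
      have h2 : ∀ i, c₂ i ∈ maxIdeal R := fun i => hkm _ (hx i) (h1 i)
      have h3 : Finsupp.linearCombination R yb c₂ ∈ S.rad Y :=
        Submodule.sum_mem _ fun i _ => S.smul_mem_rad_of_mem (h2 i) _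
      have h4 := (S.rad Y).sub_mem hc h3
      rw [add_sub_cancel_right, ← Finsupp.apply_linearCombination] at h4
      obtain ⟨y', h5⟩ := h4
      have h6 := hea.indep c₁ ⟨y', trivial, h5⟩
      rintro (i | i)
      · exact h6 i
      · exact h2 i
  obtain ⟨C, ec, hec⟩ := exists_relBasis (R := R) (N₁ := Y₂) (N₂ := ⊤)
    fun a ha n _ => Submodule.mem_sup_left (S.smul_mem_rad_of_mem ha n)
  have hY := (hY₂.sum hec le_sup_left le_top fun a ha n _ =>
    S.smul_mem_rad_of_mem ha n).reindex
      ((Equiv.sumAssoc A B C).symm.trans (Equiv.sumComm (A ⊕ B) C))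
  obtain ⟨bX, hbX⟩ := S.exists_basis_of_relBasis hX
  obtain ⟨bY, hbY⟩ := S.exists_basis_of_relBasis hY
  have hbYb : ∀ b, bY (Sum.inr (Sum.inl b)) = yb b := fun b => by rw [hbY]; rfl
  -- The distinguished subset of `B` is `B₁`, where the divided vector `yb b` was chosen in the sum
  -- of the images of `q` and `f`.
  refine ⟨A, B, C, K, bX, bY, Set.range Sum.inr, ⟨hx, fun a => ?_, fun b => ?_, fun k => ?_⟩, ?_,
    fun w ξ c y hc => ?_⟩
  · rw [hbX, hbY]; rfl
  · rw [hbX, hbYb, hyb]; rfl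
  · rw [hbX]
    change f (ek' k - x • ξk k) = 0
    rw [map_sub, map_smul, hξk, sub_self]
  · rintro _ ⟨b, rfl⟩
    exact ⟨w₁ b, ξ₁ b, hbYb _⟩
  · simp only [hbYb] at hc
    have h1 : x • Finsupp.linearCombination R yb c = x • (q w - f ξ) := by
      have : q w - f ξ = Finsupp.linearCombination R yb c + x • y := by rw [hc]; abel
      rw [this, smul_add, S.smul_smul_self, add_zero]
    rw [hxlc] at h1
    set c' := c.mapRange k hk0 with hc'
    have h2 : Finsupp.linearCombination R eb c' ∈ N'' := by
      refine ⟨_, ?_, h1.symm⟩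
      exact Submodule.sub_mem _ (Submodule.mem_sup_left ⟨w, rfl⟩)
        (Submodule.mem_sup_right ⟨ξ, rfl⟩)
    rw [linearCombination_sumElim] at h2
    have h3 := N''.sub_mem h2 (show Finsupp.linearCombination R e₁
      (Finsupp.sumFinsuppEquivProdFinsupp c').2 ∈ N'' from
        Submodule.sum_mem _ fun i _ => N''.smul_mem _ (he₁.mem i))
    rw [add_sub_cancel_right] at h3
    rintro (b | b) hb
    · exact hkm _ (hx (Sum.inl b)) (he₂.indep _ h3 b)
    · exact absurd ⟨b, rfl⟩ hb

end Setup

end NormalForm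

/-! ### Exactness and the Bockstein condition -/

section ElementwiseTriangles

variable {R : Type u} [Ring R]

/-- Elementwise description of the distinguished triangles. -/
structure ETri (x r : R) {X Y Z : Type u} [AddCommGroup X] [Module R X] [AddCommGroup Y]
    [Module R Y] [AddCommGroup Z] [Module R Z] (f : X →ₗ[R] Y) (g : Y →ₗ[R] Z)
    (h : Z →ₗ[R] X) : Prop where
  fg : Function.Exact f g
  gh : Function.Exact g h
  hf : Function.Exact h f
  bock : x ≠ 0 → ∀ v y, f v = x • y → ∃ z, g y = x • z ∧ h z = (x * r) • v

variable {X Y Z X' Y' Z' : Type u} [AddCommGroup X] [Module R X] [AddCommGroup Y] [Module R Y]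
  [AddCommGroup Z] [Module R Z] [AddCommGroup X'] [Module R X'] [AddCommGroup Y'] [Module R Y']
  [AddCommGroup Z'] [Module R Z']

namespace ETri

variable {x r : R} {f : X →ₗ[R] Y} {g : Y →ₗ[R] Z} {h : Z →ₗ[R] X}
  {f' : X' →ₗ[R] Y'} {g' : Y' →ₗ[R] Z'} {h' : Z' →ₗ[R] X'}

theorem of_equiv (E : ETri x r f g h) (eX : X ≃ₗ[R] X') (eY : Y ≃ₗ[R] Y') (eZ : Z ≃ₗ[R] Z')
    (hf : ∀ v, f' (eX v) = eY (f v)) (hg : ∀ y, g' (eY y) = eZ (g y))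
    (hh : ∀ z, h' (eZ z) = eX (h z)) : ETri x r f' g' h' := by
  refine ⟨fun y => ?_, fun z => ?_, fun v => ?_, fun hx v y hvy => ?_⟩
  · obtain ⟨y, rfl⟩ := eY.surjective y
    rw [hg, eZ.map_eq_zero_iff, E.fg y]
    constructor
    · rintro ⟨v, rfl⟩; exact ⟨eX v, hf v⟩
    · rintro ⟨v, hv⟩
      obtain ⟨v, rfl⟩ := eX.surjective v
      exact ⟨v, eY.injective (by rw [← hf, hv])⟩
  · obtain ⟨z, rfl⟩ := eZ.surjective z
    rw [hh, eX.map_eq_zero_iff, E.gh z]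
    constructor
    · rintro ⟨v, rfl⟩; exact ⟨eY v, hg v⟩
    · rintro ⟨v, hv⟩
      obtain ⟨v, rfl⟩ := eY.surjective v
      exact ⟨v, eZ.injective (by rw [← hg, hv])⟩
  · obtain ⟨v, rfl⟩ := eX.surjective v
    rw [hf, eY.map_eq_zero_iff, E.hf v]
    constructor
    · rintro ⟨v, rfl⟩; exact ⟨eZ v, hh v⟩
    · rintro ⟨z, hz⟩
      obtain ⟨z, rfl⟩ := eZ.surjective z
      exact ⟨z, eX.injective (by rw [← hh, hz])⟩
  · obtain ⟨v, rfl⟩ := eX.surjective v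
    obtain ⟨y, rfl⟩ := eY.surjective y
    obtain ⟨z, hz, hz'⟩ := E.bock hx v y (eY.injective (by rw [← hf, hvy, map_smul]))
    exact ⟨eZ z, by rw [hg, hz, map_smul], by rw [hh, hz', map_smul]⟩

end ETri

/-- Exactness holds because the annihilator of `x` is `𝔪 = Rx` and `r` is a unit. In the Bockstein
condition the elements `v`, `y`, `z`, `w` are successive preimages under `σ`, and the required
equality is precisely `cube`. -/
theorem Setup.eTri_delta [IsLocalRing R] {x r : R} (S : Setup x r) (hx : x ≠ 0) :
    ETri x r (LinearMap.toSpanSingleton R R x) (LinearMap.toSpanSingleton R R x)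
      (LinearMap.toSpanSingleton R R (r * x)) := by
  obtain ⟨⟨s, hs⟩, ⟨s', hs'⟩⟩ := And.intro S.unit.exists_left_inv S.unit.exists_right_inv
  have ann : ∀ c, c * x = 0 → c ∈ maxIdeal R := fun c hc =>
    (mem_maxIdeal_iff c).2 fun hu => hx ((hu.mul_right_eq_zero).1 hc)
  have hxrx : ∀ a, a * x * (r * x) = 0 := by
    intro a
    rw [← S.comm, mul_assoc, ← mul_assoc x, S.mul_self, zero_mul, mul_zero]
  refine ⟨fun y => ⟨fun hy => ?_, ?_⟩, fun z => ⟨fun hz => ?_, ?_⟩, fun v => ⟨fun hv => ?_, ?_⟩,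
    fun _ v y hv => ?_⟩ <;>
    simp only [Set.mem_range, LinearMap.toSpanSingleton_apply, smul_eq_mul] at *
  · obtain ⟨c, rfl⟩ := S.left y (ann y hy)
    exact ⟨c, rfl⟩
  · rintro ⟨v, rfl⟩
    rw [mul_assoc, S.mul_self, mul_zero]
  · have h1 : z * r * s' ∈ maxIdeal R :=
      Ideal.mul_mem_right _ _ (ann (z * r) (by rw [mul_assoc, hz]))
    rw [mul_assoc, hs', mul_one] at h1
    obtain ⟨c, rfl⟩ := S.left z h1
    exact ⟨c, rfl⟩
  · rintro ⟨v, rfl⟩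
    exact hxrx v
  · obtain ⟨c, rfl⟩ := S.left v (ann v hv)
    exact ⟨c * s, by rw [mul_assoc, ← mul_assoc s, hs, one_mul]⟩
  · rintro ⟨v, rfl⟩
    rw [mul_assoc, mul_assoc, S.mul_self, mul_zero, mul_zero]
  · obtain ⟨z, hz⟩ := S.exists_right y
    obtain ⟨w, hw⟩ := S.exists_right z
    refine ⟨z, hz, ?_⟩
    rw [← S.comm, ← mul_assoc, hw, mul_assoc, S.cube v y z w hv hz hw, mul_assoc]

/-- The homotopy gives exactness directly. For the Bockstein condition, `x • g y = 0` gives `g y = x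
z`, and similarly `h z = x w`; the homotopy then shows how to correct `z` by a multiple of `x`,
which leaves `x z` unchanged. -/
theorem Setup.eTri_of_contractible [IsLocalRing R] [Module.Projective R X] [Module.Projective R Z]
    {x r : R} (S : Setup x r) {f : X →ₗ[R] Y} {g : Y →ₗ[R] Z} {h : Z →ₗ[R] X}
    (fg : ∀ v, g (f v) = 0) (gh : ∀ y, h (g y) = 0) (hf : ∀ z, f (h z) = 0)
    (t : Y →ₗ[R] X) (p : Z →ₗ[R] Y) (q : X →ₗ[R] Z)
    (h₂ : ∀ y, y = p (g y) + f (t y)) (h₃ : ∀ z, z = q (h z) + g (p z))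
    (h₁ : ∀ v, v = t (f v) + h (q v)) : ETri x r f g h := by
  refine ⟨fun y => ⟨fun hy => ⟨t y, ?_⟩, ?_⟩, fun z => ⟨fun hz => ⟨p z, ?_⟩, ?_⟩,
    fun v => ⟨fun hv => ⟨q v, ?_⟩, ?_⟩, fun hx v y hv => ?_⟩
  · conv_rhs => rw [h₂ y, hy, map_zero, zero_add]
  · rintro ⟨v, rfl⟩; exact fg v
  · conv_rhs => rw [h₃ z, hz, map_zero, zero_add]
  · rintro ⟨v, rfl⟩; exact gh v
  · conv_rhs => rw [h₁ v, hv, map_zero, zero_add]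
  · rintro ⟨v, rfl⟩; exact hf v
  · obtain ⟨z, hz⟩ := S.mem_rad_of_smul_eq_zero hx (show x • g y = 0 by
      rw [← map_smul, ← hv, fg])
    obtain ⟨w, hw⟩ := S.mem_rad_of_smul_eq_zero hx (show x • h z = 0 by
      rw [← map_smul, ← hz, gh])
    have hxw : x • f w = 0 := by rw [← map_smul, ← hw, hf]
    have h4 : x • w = x • h (q w) := by
      conv_lhs => rw [h₁ w]
      rw [smul_add, ← map_smul, hxw, map_zero, zero_add]
    have h5 : (x * r) • v = (x * r) • h (q v) := by
      conv_lhs => rw [h₁ v]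
      rw [smul_add, hv, map_smul, smul_smul, S.comm, mul_assoc, S.mul_self, mul_zero, zero_smul,
        zero_add]
    refine ⟨z + x • (r • q v - q w), ?_, ?_⟩
    · rw [smul_add, S.smul_smul_self, add_zero, hz]
    · rw [map_add, hw, h4, h5, map_smul, map_sub, map_smul, smul_sub, smul_smul,
        add_sub_cancel]

theorem ETri.directSum {x r : R} {ι : Type u} {X Y Z : ι → Type u}
    [∀ i, AddCommGroup (X i)] [∀ i, Module R (X i)] [∀ i, AddCommGroup (Y i)]
    [∀ i, Module R (Y i)] [∀ i, AddCommGroup (Z i)] [∀ i, Module R (Z i)]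
    {f : ∀ i, X i →ₗ[R] Y i} {g : ∀ i, Y i →ₗ[R] Z i} {h : ∀ i, Z i →ₗ[R] X i}
    (E : ∀ i, ETri x r (f i) (g i) (h i)) :
    ETri x r (DirectSum.lmap f) (DirectSum.lmap g) (DirectSum.lmap h) := by
  classical
  have exact : ∀ {X Y Z : ι → Type u}
    [∀ i, AddCommGroup (X i)] [∀ i, Module R (X i)] [∀ i, AddCommGroup (Y i)]
    [∀ i, Module R (Y i)] [∀ i, AddCommGroup (Z i)] [∀ i, Module R (Z i)]
    {f : ∀ i, X i →ₗ[R] Y i} {g : ∀ i, Y i →ₗ[R] Z i}, (∀ i, Function.Exact (f i) (g i)) →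
      Function.Exact (DirectSum.lmap f) (DirectSum.lmap g) := by
    intro X Y Z _ _ _ _ _ _ f g hfg
    rw [LinearMap.exact_iff, DirectSum.ker_lmap, DirectSum.range_lmap]
    simp only [fun i => (LinearMap.exact_iff.1 (hfg i))]
  refine ⟨exact fun i => (E i).fg, exact fun i => (E i).gh, exact fun i => (E i).hf,
    fun hx v y hv => ?_⟩
  -- The last clause makes the chosen `z` vanish outside the finite supports of `v` and `y`, so that
  -- it defines an element of the direct sum.
  have key : ∀ i, ∃ z, g i (y i) = x • z ∧ h i z = (x * r) • v i ∧ (v i = 0 ∧ y i = 0 → z = 0) := by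
    intro i
    by_cases h0 : v i = 0 ∧ y i = 0
    · exact ⟨0, by simp [h0]⟩
    · obtain ⟨z, hz, hz'⟩ := (E i).bock hx (v i) (y i) (by
        exact DFunLike.congr_fun hv i)
      exact ⟨z, hz, hz', fun h => absurd h h0⟩
  choose z hz hz' hz0 using key
  let z₀ := DirectSum.mk Z (v.support ∪ y.support) fun i => z i
  have hz₀ : ∀ i, z₀ i = z i := by
    intro i
    by_cases hi : i ∈ v.support ∪ y.support
    · exact DirectSum.mk_apply_of_mem hi
    · refine (DirectSum.mk_apply_of_notMem hi).trans (hz0 i ?_).symm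
      simpa [not_or] using hi
  refine ⟨z₀, DFinsupp.ext fun i => ?_, DFinsupp.ext fun i => ?_⟩
  · change g i (y i) = x • z₀ i
    rw [hz₀, hz]
  · change h i (z₀ i) = (x * r) • v i
    rw [hz₀, hz']

end ElementwiseTriangles

/-! ### Passage to triangles in full subcategories of modules -/

section Categorical

attribute [local instance] idShift

open ZeroObject

variable {R : Type u} [Ring R] {P : ObjectProperty (ModuleCat.{u} R)}

/-- The linear map underlying a morphism in a full subcategory of modules. -/
abbrev lin {M N : P.FullSubcategory} (f : M ⟶ N) : M.obj →ₗ[R] N.obj := f.hom.hom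

/-- The morphism in a full subcategory of modules given by a linear map. -/
abbrev ofLin {M N : P.FullSubcategory} (f : M.obj →ₗ[R] N.obj) : M ⟶ N :=
  ObjectProperty.homMk (ModuleCat.ofHom f)

theorem hom_ext_lin {M N : P.FullSubcategory} {f g : M ⟶ N} (h : ∀ m, lin f m = lin g m) :
    f = g :=
  ObjectProperty.hom_ext _ (ModuleCat.hom_ext (LinearMap.ext h))

/-- The last map of a triangle with `Σ = Id`. -/
abbrev lin₃ (T : IdTriangle P.FullSubcategory) : T.obj₃.obj →ₗ[R] T.obj₁.obj :=
  lin (N := T.obj₁) T.mor₃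

section Morphisms

variable {T T' : IdTriangle P.FullSubcategory}

theorem triangleHom_comm₁ (φ : T ⟶ T') (v : T.obj₁.obj) :
    lin φ.hom₂ (lin T.mor₁ v) = lin T'.mor₁ (lin φ.hom₁ v) :=
  LinearMap.congr_fun (congrArg lin φ.comm₁) v

theorem triangleHom_comm₂ (φ : T ⟶ T') (v : T.obj₂.obj) :
    lin φ.hom₃ (lin T.mor₂ v) = lin T'.mor₂ (lin φ.hom₂ v) :=
  LinearMap.congr_fun (congrArg lin φ.comm₂) v

theorem triangleHom_comm₃ (φ : T ⟶ T') (v : T.obj₃.obj) :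
    lin φ.hom₁ (lin₃ T v) = lin₃ T' (lin φ.hom₃ v) :=
  LinearMap.congr_fun (congrArg (fun f => lin (N := T'.obj₁) f) φ.comm₃) v

theorem triangleHom_ext {φ ψ : T ⟶ T'} (h₁ : ∀ v, lin φ.hom₁ v = lin ψ.hom₁ v)
    (h₂ : ∀ v, lin φ.hom₂ v = lin ψ.hom₂ v) (h₃ : ∀ v, lin φ.hom₃ v = lin ψ.hom₃ v) : φ = ψ :=
  TriangleMorphism.ext (hom_ext_lin h₁) (hom_ext_lin h₂) (hom_ext_lin h₃)

/-- Morphisms of triangles from linear maps. -/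
def triangleHomMk (a : T.obj₁.obj →ₗ[R] T'.obj₁.obj) (b : T.obj₂.obj →ₗ[R] T'.obj₂.obj)
    (c : T.obj₃.obj →ₗ[R] T'.obj₃.obj) (h₁ : ∀ v, b (lin T.mor₁ v) = lin T'.mor₁ (a v))
    (h₂ : ∀ v, c (lin T.mor₂ v) = lin T'.mor₂ (b v)) (h₃ : ∀ v, a (lin₃ T v) = lin₃ T' (c v)) :
    T ⟶ T' where
  hom₁ := ofLin a
  hom₂ := ofLin b
  hom₃ := ofLin c
  comm₁ := hom_ext_lin h₁
  comm₂ := hom_ext_lin h₂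
  comm₃ := hom_ext_lin (N := T'.obj₁) h₃

theorem lin_inv_hom {M N : P.FullSubcategory} (e : M ≅ N) (m : M.obj) :
    lin e.inv (lin e.hom m) = m :=
  LinearMap.congr_fun (congrArg lin e.hom_inv_id) m

/-- The linear equivalence underlying an isomorphism. -/
def linEquiv {M N : P.FullSubcategory} (e : M ≅ N) : M.obj ≃ₗ[R] N.obj :=
  { lin e.hom with
    invFun := lin e.inv
    left_inv := lin_inv_hom e
    right_inv := lin_inv_hom e.symm }

end Morphisms

variable (P) in
/-- The triangles described by `ETri`. -/
def eTriangles (x r : R) : Set (IdTriangle P.FullSubcategory) :=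
  {T | ETri x r (lin T.mor₁) (lin T.mor₂) (lin₃ T)}

theorem eTriangles_of_iso {x r : R} {T T' : IdTriangle P.FullSubcategory} (e : T ≅ T')
    (hT : T ∈ eTriangles P x r) : T' ∈ eTriangles P x r :=
  ETri.of_equiv hT (linEquiv (Triangle.π₁.mapIso e)) (linEquiv (Triangle.π₂.mapIso e))
    (linEquiv (Triangle.π₃.mapIso e)) (fun v => (triangleHom_comm₁ e.hom v).symm)
    (fun v => (triangleHom_comm₂ e.hom v).symm) (fun v => (triangleHom_comm₃ e.hom v).symm)

theorem Setup.eTriangles_of_isContractible [IsLocalRing R] {x r : R} (S : Setup x r)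
    (hP : ∀ M, P M → Module.Projective R M) {T : IdTriangle P.FullSubcategory}
    (hT : IsContractible T) : T ∈ eTriangles P x r := by
  obtain ⟨h12, h23, h31, t, p, q, e₂, e₃, e₁⟩ := hT
  have := hP _ T.obj₁.2
  have := hP _ T.obj₃.2
  exact S.eTri_of_contractible (f := lin T.mor₁) (g := lin T.mor₂) (h := lin₃ T)
    (fun v => LinearMap.congr_fun (congrArg lin h12) v)
    (fun v => LinearMap.congr_fun (congrArg (fun f => lin (N := T.obj₁) f) h23) v)
    (fun v => LinearMap.congr_fun (congrArg (fun f => lin (N := T.obj₂) f) h31) v)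
    (lin t) (lin p) (lin (M := T.obj₁) q)
    (fun v => LinearMap.congr_fun (congrArg lin e₂) v)
    (fun v => LinearMap.congr_fun (congrArg lin e₃) v)
    (fun v => LinearMap.congr_fun
      (congrArg (fun f => lin (M := T.obj₁) (N := T.obj₁) f) e₁) v)

/-- A coproduct of triangles is unique up to isomorphism, so it suffices to exhibit the termwise
direct sum as one; `hι` keeps its terms inside the subcategory. -/
theorem eTriangles_of_isColimit {x r : R} {ι : Type u}
    (hι : ∀ M : ι → Type u, ∀ _ : ∀ i, AddCommGroup (M i), ∀ _ : ∀ i, Module R (M i),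
      (∀ i, P (ModuleCat.of R (M i))) → P (ModuleCat.of R (DirectSum ι M)))
    {F : ι → IdTriangle P.FullSubcategory} {c : Cofan F} (hc : IsColimit c)
    (hE : ∀ i, F i ∈ eTriangles P x r) : c.pt ∈ eTriangles P x r := by
  classical
  let D₁ : P.FullSubcategory := ⟨_, hι (fun i => (F i).obj₁.obj) _ _ fun i => (F i).obj₁.2⟩
  let D₂ : P.FullSubcategory := ⟨_, hι (fun i => (F i).obj₂.obj) _ _ fun i => (F i).obj₂.2⟩
  let D₃ : P.FullSubcategory := ⟨_, hι (fun i => (F i).obj₃.obj) _ _ fun i => (F i).obj₃.2⟩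
  let D : IdTriangle P.FullSubcategory := Triangle.mk
    (ofLin (M := D₁) (N := D₂) (DirectSum.lmap fun i => lin (F i).mor₁))
    (ofLin (M := D₂) (N := D₃) (DirectSum.lmap fun i => lin (F i).mor₂))
    (ofLin (M := D₃) (N := D₁) (DirectSum.lmap fun i => lin₃ (F i)))
  have hD : D ∈ eTriangles P x r := ETri.directSum hE
  let d : Cofan F := Cofan.mk D fun i => triangleHomMk
    (DirectSum.lof R ι (fun i => (F i).obj₁.obj) i) (DirectSum.lof R ι (fun i => (F i).obj₂.obj) i)
    (DirectSum.lof R ι (fun i => (F i).obj₃.obj) i) 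
    (fun v => (DirectSum.lmap_lof (fun i => lin (F i).mor₁) i v).symm)
    (fun v => (DirectSum.lmap_lof (fun i => lin (F i).mor₂) i v).symm)
    (fun v => (DirectSum.lmap_lof (fun i => lin₃ (F i)) i v).symm)
  have hd : IsColimit d := by
    refine Cofan.IsColimit.mk _ (fun s => triangleHomMk
      (DirectSum.toModule R ι s.pt.obj₁.obj fun i => lin (s.inj i).hom₁)
      (DirectSum.toModule R ι s.pt.obj₂.obj fun i => lin (s.inj i).hom₂)
      (DirectSum.toModule R ι s.pt.obj₃.obj fun i => lin (s.inj i).hom₃)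
      (LinearMap.congr_fun (f := DirectSum.toModule R ι s.pt.obj₂.obj _ ∘ₗ
        DirectSum.lmap fun i => lin (F i).mor₁) (g := lin s.pt.mor₁ ∘ₗ DirectSum.toModule R ι _ _)
        (DirectSum.linearMap_ext R fun i => LinearMap.ext fun v => ?_))
      (LinearMap.congr_fun (f := DirectSum.toModule R ι s.pt.obj₃.obj _ ∘ₗ
        DirectSum.lmap fun i => lin (F i).mor₂) (g := lin s.pt.mor₂ ∘ₗ DirectSum.toModule R ι _ _)
        (DirectSum.linearMap_ext R fun i => LinearMap.ext fun v => ?_))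
      (LinearMap.congr_fun (f := DirectSum.toModule R ι s.pt.obj₁.obj _ ∘ₗ
        DirectSum.lmap fun i => lin₃ (F i)) (g := lin₃ s.pt ∘ₗ DirectSum.toModule R ι _ _)
        (DirectSum.linearMap_ext R fun i => LinearMap.ext fun v => ?_)))
      (fun s i => triangleHom_ext
        (fun v => DirectSum.toModule_lof R (φ := fun i => lin (s.inj i).hom₁) i v)
        (fun v => DirectSum.toModule_lof R (φ := fun i => lin (s.inj i).hom₂) i v)
        (fun v => DirectSum.toModule_lof R (φ := fun i => lin (s.inj i).hom₃) i v))
      (fun s m hm => triangleHom_ext ?_ ?_ ?_)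
    · simpa using triangleHom_comm₁ (s.inj i) v
    · simpa using triangleHom_comm₂ (s.inj i) v
    · simpa using triangleHom_comm₃ (s.inj i) v
    · refine LinearMap.congr_fun (f := lin m.hom₁) (DirectSum.linearMap_ext R fun i => ?_)
      refine LinearMap.ext fun v => (LinearMap.congr_fun (congrArg (fun φ : F i ⟶ s.pt =>
        lin φ.hom₁) (hm i)) v).trans
        (DirectSum.toModule_lof R (φ := fun i => lin (s.inj i).hom₁) i v).symm
    · refine LinearMap.congr_fun (f := lin m.hom₂) (DirectSum.linearMap_ext R fun i => ?_)
      refine LinearMap.ext fun v => (LinearMap.congr_fun (congrArg (fun φ : F i ⟶ s.pt =>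
        lin φ.hom₂) (hm i)) v).trans
        (DirectSum.toModule_lof R (φ := fun i => lin (s.inj i).hom₂) i v).symm
    · refine LinearMap.congr_fun (f := lin m.hom₃) (DirectSum.linearMap_ext R fun i => ?_)
      refine LinearMap.ext fun v => (LinearMap.congr_fun (congrArg (fun φ : F i ⟶ s.pt =>
        lin φ.hom₃) (hm i)) v).trans
        (DirectSum.toModule_lof R (φ := fun i => lin (s.inj i).hom₃) i v).symm
  exact eTriangles_of_iso (hd.coconePointUniqueUpToIso hc) hD

theorem Setup.eTriangles_of_sum [IsLocalRing R] {x r : R} (S : Setup x r) (hx : x ≠ 0)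
    (hP : ∀ M, P M → Module.Projective R M) (hR : P (ModuleCat.of R R)) {ι : Type u}
    (hι : ∀ M : ι → Type u, ∀ _ : ∀ i, AddCommGroup (M i), ∀ _ : ∀ i, Module R (M i),
      (∀ i, P (ModuleCat.of R (M i))) → P (ModuleCat.of R (DirectSum ι M)))
    {T : IdTriangle P.FullSubcategory}
    (hT : IsSumOfContractibleOr (deltaTriangle hR x r) ι T) : T ∈ eTriangles P x r := by
  obtain ⟨F, c, hF, ⟨hc⟩, ⟨e⟩⟩ := hT
  refine eTriangles_of_iso e.symm (eTriangles_of_isColimit hι hc fun i => ?_)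
  rcases hF i with h | h
  · exact S.eTriangles_of_isContractible hP h
  · rw [h]
    exact S.eTri_delta hx

end Categorical

/-! ### Triangles in normal form as coproducts of elementary triangles -/

section Decomposition

attribute [local instance] idShift

open ZeroObject

variable {R : Type u} [Ring R] {P : ObjectProperty (ModuleCat.{u} R)} [P.ContainsZero]

/-- `R` as an object of a full subcategory. -/
abbrev regObj (hR : P (ModuleCat.of R R)) : P.FullSubcategory := ⟨ModuleCat.of R R, hR⟩

variable (P) in
/-- A zero object of a full subcategory. -/
noncomputable abbrev zeroObj : P.FullSubcategory := 0

instance : Subsingleton (0 : P.FullSubcategory).obj where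
  allEq a b := by
    have h : (𝟙 (0 : P.FullSubcategory)) = 0 := (isZero_zero (P.FullSubcategory)).eq_of_src _ _
    have h' : ∀ c : (0 : P.FullSubcategory).obj, c = 0 := fun c =>
      LinearMap.congr_fun (congrArg lin h) c
    rw [h' a, h' b]

/-- The indecomposable triangles occurring in a normal form. -/
noncomputable def nfFamily (hR : P (ModuleCat.of R R)) (x r : R) (A B C K : Type u) :
    A ⊕ B ⊕ C ⊕ K → IdTriangle P.FullSubcategory
  | Sum.inl _ => Triangle.mk (Z := zeroObj P) (𝟙 (regObj hR)) 0 0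
  | Sum.inr (Sum.inl _) => deltaTriangle hR x r
  | Sum.inr (Sum.inr (Sum.inl _)) => Triangle.mk (X := zeroObj P) 0 (𝟙 (regObj hR)) 0
  | Sum.inr (Sum.inr (Sum.inr _)) =>
    Triangle.mk (X := regObj hR) (Y := zeroObj P) (Z := regObj hR) 0 0 (𝟙 (regObj hR))

theorem nfFamily_spec (hR : P (ModuleCat.of R R)) (x r : R) {A B C K : Type u}
    (i : A ⊕ B ⊕ C ⊕ K) : IsContractible (nfFamily hR x r A B C K i) ∨
      Nonempty B ∧ nfFamily hR x r A B C K i = deltaTriangle hR x r := by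
  rcases i with i | i | i | i
  · refine Or.inl ⟨(isZero_zero (P.FullSubcategory)).eq_of_tgt _ _, zero_comp,
      (isZero_zero (P.FullSubcategory)).eq_of_src _ _, 𝟙 _, 0, 0, ?_,
          (isZero_zero (P.FullSubcategory)).eq_of_src _ _, ?_⟩
    · exact hom_ext_lin fun m => (zero_add (m : R)).symm
    · exact hom_ext_lin (M := regObj hR) (N := regObj hR) fun m => (add_zero (m : R)).symm
  · exact Or.inr ⟨⟨i⟩, rfl⟩
  · refine Or.inl ⟨(isZero_zero (P.FullSubcategory)).eq_of_src _ _,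
      (isZero_zero (P.FullSubcategory)).eq_of_tgt _ _,
      zero_comp, 0, 𝟙 _, 0, ?_, ?_,
      (isZero_zero (P.FullSubcategory)).eq_of_src _ _⟩
    · exact hom_ext_lin fun m => (add_zero (m : R)).symm
    · exact hom_ext_lin fun m => (zero_add (m : R)).symm
  · refine Or.inl ⟨zero_comp, (isZero_zero (P.FullSubcategory)).eq_of_src _ _,
      (isZero_zero (P.FullSubcategory)).eq_of_tgt _ _, 0, 0, 𝟙 (regObj hR),
      (isZero_zero (P.FullSubcategory)).eq_of_src _ _, ?_, ?_⟩
    · exact hom_ext_lin fun m => (add_zero (m : R)).symm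
    · exact hom_ext_lin (M := regObj hR) (N := regObj hR) fun m => (zero_add (m : R)).symm

section

variable (hR : P (ModuleCat.of R R)) {x r : R} {A B C K : Type u}
  {T : IdTriangle P.FullSubcategory}
  {bX : Module.Basis (A ⊕ B ⊕ K) R T.obj₁.obj} {bY : Module.Basis (A ⊕ B ⊕ C) R T.obj₂.obj}
  {bZ : Module.Basis (B ⊕ C ⊕ K) R T.obj₃.obj}
  (N : TriNF x r bX bY bZ (lin T.mor₁) (lin T.mor₂) (lin₃ T))

/-- The inclusions of the summands of a triangle in normal form. -/
noncomputable def nfInclusion (hxr : x * r = r * x) (i : A ⊕ B ⊕ C ⊕ K) :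
    nfFamily hR x r A B C K i ⟶ T :=
  match i with
  | Sum.inl a => triangleHomMk (LinearMap.toSpanSingleton R _ (bX (Sum.inl a)))
      (LinearMap.toSpanSingleton R _ (bY (Sum.inl a))) 0 
      (fun v : R => by
        change v • bY _ = lin T.mor₁ (v • bX _)
        rw [map_smul, N.fa])
      (fun v : R => by
        change 0 = lin T.mor₂ (v • bY _)
        rw [map_smul, N.ga, smul_zero])
      (fun v => by
        change (0 : R) • bX _ = lin₃ T 0
        rw [map_zero, zero_smul])
  | Sum.inr (Sum.inl b) => triangleHomMk
      (LinearMap.toSpanSingleton R _ (bX (Sum.inr (Sum.inl b))))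
      (LinearMap.toSpanSingleton R _ (bY (Sum.inr (Sum.inl b))))
      (LinearMap.toSpanSingleton R _ (bZ (Sum.inl b)))
      (fun v : R => by
        change (v * x) • bY _ = lin T.mor₁ (v • bX _)
        rw [map_smul, N.fb, smul_smul])
      (fun v : R => by
        change (v * x) • bZ _ = lin T.mor₂ (v • bY _)
        rw [map_smul, N.gb, smul_smul])
      (fun v : R => by
        change (v * (r * x)) • bX _ = lin₃ T (v • bZ _)
        rw [map_smul, N.hb, smul_smul, hxr])
  | Sum.inr (Sum.inr (Sum.inl c)) => triangleHomMk 0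
      (LinearMap.toSpanSingleton R _ (bY (Sum.inr (Sum.inr c))))
      (LinearMap.toSpanSingleton R _ (bZ (Sum.inr (Sum.inl c))))
      (fun v => by
        change (0 : R) • bY _ = lin T.mor₁ 0
        rw [map_zero, zero_smul])
      (fun v : R => by
        change v • bZ _ = lin T.mor₂ (v • bY _)
        rw [map_smul, N.gc])
      (fun v : R => by
        change 0 = lin₃ T (v • bZ _)
        rw [map_smul, N.hc, smul_zero])
  | Sum.inr (Sum.inr (Sum.inr k)) => triangleHomMk
      (LinearMap.toSpanSingleton R _ (bX (Sum.inr (Sum.inr k)))) 0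
      (LinearMap.toSpanSingleton R _ (bZ (Sum.inr (Sum.inr k))))
      (fun v : R => by
        change 0 = lin T.mor₁ (v • bX _)
        rw [map_smul, N.fk, smul_zero])
      (fun v => by
        change (0 : R) • bZ _ = lin T.mor₂ 0
        rw [map_zero, zero_smul])
      (fun v : R => by
        change v • bX _ = lin₃ T (v • bZ _)
        rw [map_smul, N.hk])

include N in
-- A map out of any summand is determined by the images of the generators `1`, and the union of
-- these generators gives the three bases. The relations in the normal form are exactly what makes
-- the maps defined on the bases commute.
theorem nonempty_isColimit_of_triNF (hxr : x * r = r * x) :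
    Nonempty (IsColimit (Cofan.mk T (nfInclusion hR N hxr))) := by
  have hone : ∀ {M : Type u} [AddCommGroup M] [Module R M] (φ : R →ₗ[R] M) (a : R),
      φ (1 * a) = a • φ 1 := by
    intro M _ _ φ a
    rw [one_mul, ← map_smul, smul_eq_mul, mul_one]
  let ι₁ : (s : Cofan (nfFamily hR x r A B C K)) → A ⊕ B ⊕ K → s.pt.obj₁.obj := fun s i =>
    match i with
    | Sum.inl a => lin (M := regObj hR) (s.inj (Sum.inl a)).hom₁ (1 : R)
    | Sum.inr (Sum.inl b) => lin (M := regObj hR) (s.inj (Sum.inr (Sum.inl b))).hom₁ (1 : R)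
    | Sum.inr (Sum.inr k) =>
      lin (M := regObj hR) (s.inj (Sum.inr (Sum.inr (Sum.inr k)))).hom₁ (1 : R)
  let ι₂ : (s : Cofan (nfFamily hR x r A B C K)) → A ⊕ B ⊕ C → s.pt.obj₂.obj := fun s i =>
    match i with
    | Sum.inl a => lin (M := regObj hR) (s.inj (Sum.inl a)).hom₂ (1 : R)
    | Sum.inr (Sum.inl b) => lin (M := regObj hR) (s.inj (Sum.inr (Sum.inl b))).hom₂ (1 : R)
    | Sum.inr (Sum.inr c) =>
      lin (M := regObj hR) (s.inj (Sum.inr (Sum.inr (Sum.inl c)))).hom₂ (1 : R)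
  let ι₃ : (s : Cofan (nfFamily hR x r A B C K)) → B ⊕ C ⊕ K → s.pt.obj₃.obj := fun s i =>
    match i with
    | Sum.inl b => lin (M := regObj hR) (s.inj (Sum.inr (Sum.inl b))).hom₃ (1 : R)
    | Sum.inr (Sum.inl c) =>
      lin (M := regObj hR) (s.inj (Sum.inr (Sum.inr (Sum.inl c)))).hom₃ (1 : R)
    | Sum.inr (Sum.inr k) =>
      lin (M := regObj hR) (s.inj (Sum.inr (Sum.inr (Sum.inr k)))).hom₃ (1 : R)
  refine ⟨Cofan.IsColimit.mk _ (fun s => triangleHomMk (bX.constr ℕ (ι₁ s)) (bY.constr ℕ (ι₂ s))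
    (bZ.constr ℕ (ι₃ s))
    (LinearMap.congr_fun (f := (bY.constr ℕ (ι₂ s)) ∘ₗ lin T.mor₁)
      (g := lin s.pt.mor₁ ∘ₗ bX.constr ℕ (ι₁ s)) (bX.ext ?_))
    (LinearMap.congr_fun (f := (bZ.constr ℕ (ι₃ s)) ∘ₗ lin T.mor₂)
      (g := lin s.pt.mor₂ ∘ₗ bY.constr ℕ (ι₂ s)) (bY.ext ?_))
    (LinearMap.congr_fun (f := (bX.constr ℕ (ι₁ s)) ∘ₗ lin₃ T)
      (g := lin₃ s.pt ∘ₗ bZ.constr ℕ (ι₃ s)) (bZ.ext ?_)))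
    (fun s i => ?_) (fun s m hm => triangleHom_ext ?_ ?_ ?_)⟩
  · rintro (a | b | k) <;> simp only [LinearMap.comp_apply, Module.Basis.constr_basis]
    · rw [N.fa, bY.constr_basis]
      exact triangleHom_comm₁ (s.inj (Sum.inl a)) (1 : R)
    · rw [N.fb, map_smul, bY.constr_basis, ← hone]
      exact triangleHom_comm₁ (s.inj (Sum.inr (Sum.inl b))) (1 : R)
    · rw [N.fk, map_zero]
      exact (map_zero _).symm.trans
        (triangleHom_comm₁ (s.inj (Sum.inr (Sum.inr (Sum.inr k)))) (1 : R))
  · rintro (a | b | c) <;> simp only [LinearMap.comp_apply, Module.Basis.constr_basis]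
    · rw [N.ga, map_zero]
      exact (map_zero _).symm.trans (triangleHom_comm₂ (s.inj (Sum.inl a)) (1 : R))
    · rw [N.gb, map_smul, bZ.constr_basis, ← hone]
      exact triangleHom_comm₂ (s.inj (Sum.inr (Sum.inl b))) (1 : R)
    · rw [N.gc, bZ.constr_basis]
      exact triangleHom_comm₂ (s.inj (Sum.inr (Sum.inr (Sum.inl c)))) (1 : R)
  · rintro (b | c | k) <;> simp only [LinearMap.comp_apply, Module.Basis.constr_basis]
    · rw [N.hb, map_smul, bX.constr_basis, hxr, ← hone]
      exact triangleHom_comm₃ (s.inj (Sum.inr (Sum.inl b))) (1 : R)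
    · rw [N.hc, map_zero]
      exact (map_zero _).symm.trans
        (triangleHom_comm₃ (s.inj (Sum.inr (Sum.inr (Sum.inl c)))) (1 : R))
    · rw [N.hk, bX.constr_basis]
      exact triangleHom_comm₃ (s.inj (Sum.inr (Sum.inr (Sum.inr k)))) (1 : R)
  · have hv : ∀ {M M' : Type u} [AddCommGroup M] [Module R M] [AddCommGroup M'] [Module R M']
        {φ : M →ₗ[R] M'} {e : M} {φ' : R →ₗ[R] M'}, φ e = φ' 1 → ∀ v : R, φ (v • e) = φ' v := by
      intro M M' _ _ _ _ φ e φ' h v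
      rw [map_smul, h, ← map_smul, smul_eq_mul, mul_one]
    rcases i with a | b | c | k
    · exact TriangleMorphism.ext
        (hom_ext_lin (M := regObj hR) (hv (φ := bX.constr ℕ (ι₁ s))
          (φ' := lin (M := regObj hR) (s.inj (Sum.inl a)).hom₁) (bX.constr_basis ..)))
        (hom_ext_lin (M := regObj hR) (hv (φ := bY.constr ℕ (ι₂ s))
          (φ' := lin (M := regObj hR) (s.inj (Sum.inl a)).hom₂) (bY.constr_basis ..)))
        ((isZero_zero (P.FullSubcategory)).eq_of_src _ _)
    · exact TriangleMorphism.ext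
        (hom_ext_lin (M := regObj hR) (hv (φ := bX.constr ℕ (ι₁ s))
          (φ' := lin (M := regObj hR) (s.inj (Sum.inr (Sum.inl b))).hom₁) (bX.constr_basis ..)))
        (hom_ext_lin (M := regObj hR) (hv (φ := bY.constr ℕ (ι₂ s))
          (φ' := lin (M := regObj hR) (s.inj (Sum.inr (Sum.inl b))).hom₂) (bY.constr_basis ..)))
        (hom_ext_lin (M := regObj hR) (hv (φ := bZ.constr ℕ (ι₃ s))
          (φ' := lin (M := regObj hR) (s.inj (Sum.inr (Sum.inl b))).hom₃) (bZ.constr_basis ..)))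
    · exact TriangleMorphism.ext
        ((isZero_zero (P.FullSubcategory)).eq_of_src _ _)
        (hom_ext_lin (M := regObj hR) (hv (φ := bY.constr ℕ (ι₂ s))
          (φ' := lin (M := regObj hR) (s.inj (Sum.inr (Sum.inr (Sum.inl c)))).hom₂)
              (bY.constr_basis ..)))
        (hom_ext_lin (M := regObj hR) (hv (φ := bZ.constr ℕ (ι₃ s))
          (φ' := lin (M := regObj hR) (s.inj (Sum.inr (Sum.inr (Sum.inl c)))).hom₃)
              (bZ.constr_basis ..)))
    · exact TriangleMorphism.ext
        (hom_ext_lin (M := regObj hR) (hv (φ := bX.constr ℕ (ι₁ s))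
          (φ' := lin (M := regObj hR) (s.inj (Sum.inr (Sum.inr (Sum.inr k)))).hom₁)
              (bX.constr_basis ..)))
        ((isZero_zero (P.FullSubcategory)).eq_of_src _ _)
        (hom_ext_lin (M := regObj hR) (hv (φ := bZ.constr ℕ (ι₃ s))
          (φ' := lin (M := regObj hR) (s.inj (Sum.inr (Sum.inr (Sum.inr k)))).hom₃)
              (bZ.constr_basis ..)))
  · refine LinearMap.congr_fun (f := lin m.hom₁) (g := bX.constr ℕ (ι₁ s)) (bX.ext ?_)
    have hm' := fun i => congrArg (fun φ => TriangleMorphism.hom₁ φ) (hm i)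
    rintro (a | b | k) <;> rw [bX.constr_basis]
    · exact (congrArg (lin m.hom₁) (one_smul R (bX (Sum.inl a)))).symm.trans
        (LinearMap.congr_fun (congrArg (fun φ => lin (M := regObj hR) φ) (hm' (Sum.inl a))) (1 : R))
    · exact (congrArg (lin m.hom₁) (one_smul R (bX (Sum.inr (Sum.inl b))))).symm.trans
        (LinearMap.congr_fun (congrArg (fun φ => lin (M := regObj hR) φ)
          (hm' (Sum.inr (Sum.inl b)))) (1 : R))
    · exact (congrArg (lin m.hom₁) (one_smul R (bX (Sum.inr (Sum.inr k))))).symm.trans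
        (LinearMap.congr_fun (congrArg (fun φ => lin (M := regObj hR) φ)
          (hm' (Sum.inr (Sum.inr (Sum.inr k))))) (1 : R))
  · refine LinearMap.congr_fun (f := lin m.hom₂) (g := bY.constr ℕ (ι₂ s)) (bY.ext ?_)
    have hm' := fun i => congrArg (fun φ => TriangleMorphism.hom₂ φ) (hm i)
    rintro (a | b | c) <;> rw [bY.constr_basis]
    · exact (congrArg (lin m.hom₂) (one_smul R (bY (Sum.inl a)))).symm.trans
        (LinearMap.congr_fun (congrArg (fun φ => lin (M := regObj hR) φ) (hm' (Sum.inl a))) (1 : R))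
    · exact (congrArg (lin m.hom₂) (one_smul R (bY (Sum.inr (Sum.inl b))))).symm.trans
        (LinearMap.congr_fun (congrArg (fun φ => lin (M := regObj hR) φ)
          (hm' (Sum.inr (Sum.inl b)))) (1 : R))
    · exact (congrArg (lin m.hom₂) (one_smul R (bY (Sum.inr (Sum.inr c))))).symm.trans
        (LinearMap.congr_fun (congrArg (fun φ => lin (M := regObj hR) φ)
          (hm' (Sum.inr (Sum.inr (Sum.inl c))))) (1 : R))
  · refine LinearMap.congr_fun (f := lin m.hom₃) (g := bZ.constr ℕ (ι₃ s)) (bZ.ext ?_)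
    have hm' := fun i => congrArg (fun φ => TriangleMorphism.hom₃ φ) (hm i)
    rintro (b | c | k) <;> rw [bZ.constr_basis]
    · exact (congrArg (lin m.hom₃) (one_smul R (bZ (Sum.inl b)))).symm.trans
        (LinearMap.congr_fun (congrArg (fun φ => lin (M := regObj hR) φ)
          (hm' (Sum.inr (Sum.inl b)))) (1 : R))
    · exact (congrArg (lin m.hom₃) (one_smul R (bZ (Sum.inr (Sum.inl c))))).symm.trans
        (LinearMap.congr_fun (congrArg (fun φ => lin (M := regObj hR) φ)
          (hm' (Sum.inr (Sum.inr (Sum.inl c))))) (1 : R))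
    · exact (congrArg (lin m.hom₃) (one_smul R (bZ (Sum.inr (Sum.inr k))))).symm.trans
        (LinearMap.congr_fun (congrArg (fun φ => lin (M := regObj hR) φ)
          (hm' (Sum.inr (Sum.inr (Sum.inr k))))) (1 : R))

include N in
theorem isSumOfContractibleOr_of_triNF (hxr : x * r = r * x) :
    IsSumOfContractibleOr (deltaTriangle hR x r) (A ⊕ B ⊕ C ⊕ K) T :=
  ⟨nfFamily hR x r A B C K, Cofan.mk T (nfInclusion hR N hxr),
    fun i => (nfFamily_spec hR x r i).imp_right And.right,
    nonempty_isColimit_of_triNF hR N hxr, ⟨Iso.refl _⟩⟩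

end

theorem projective_directSum {ι : Type u} (M : ι → Type u) [∀ i, AddCommGroup (M i)]
    [∀ i, Module R (M i)] (h : ∀ i, isProj R (ModuleCat.of R (M i))) :
    isProj R (ModuleCat.of R (DirectSum ι M)) := by
  have : ∀ i, Module.Projective R (M i) := h
  exact (inferInstance : Module.Projective R (DirectSum ι M))

/-- Viewed in the category of projective modules, the triangle is a coproduct of elementary ones,
each of which satisfies `ETri`. A copy of the `x` triangle occurs only when `x ≠ 0`. -/
theorem Setup.eTri_of_triNF [IsLocalRing R] {x r : R} (S : Setup x r) {X Y Z : Type u}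
    [AddCommGroup X] [Module R X] [AddCommGroup Y] [Module R Y] [AddCommGroup Z] [Module R Z]
    {A B C K : Type u} {bX : Module.Basis (A ⊕ B ⊕ K) R X} {bY : Module.Basis (A ⊕ B ⊕ C) R Y}
    {bZ : Module.Basis (B ⊕ C ⊕ K) R Z} {f : X →ₗ[R] Y} {g : Y →ₗ[R] Z} {h : Z →ₗ[R] X}
    (N : TriNF x r bX bY bZ f g h) : ETri x r f g h := by
  let oX : ProjCat R := ⟨ModuleCat.of R X, Module.Projective.of_basis bX⟩
  let oY : ProjCat R := ⟨ModuleCat.of R Y, Module.Projective.of_basis bY⟩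
  let oZ : ProjCat R := ⟨ModuleCat.of R Z, Module.Projective.of_basis bZ⟩
  let T : IdTriangle (ProjCat R) := Triangle.mk (ofLin (M := oX) (N := oY) f)
    (ofLin (M := oY) (N := oZ) g) (ofLin (M := oZ) (N := oX) h)
  obtain ⟨hc⟩ := nonempty_isColimit_of_triNF (T := T) (isProj_self R) N S.comm
  refine eTriangles_of_isColimit (fun M _ _ hM => projective_directSum M hM) hc fun i => ?_
  rcases nfFamily_spec (isProj_self R) x r i with h | ⟨⟨b⟩, h⟩
  · exact S.eTriangles_of_isContractible (fun _ h => h) h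
  · rw [h]
    exact S.eTri_delta (N.ne b)

end Decomposition

/-! ### Rotation, completion of morphisms and the special octahedron -/

section Axioms

variable {R : Type u} [Ring R]
variable {X Y Z W X' Y' Z' : Type u} [AddCommGroup X] [Module R X] [AddCommGroup Y] [Module R Y]
  [AddCommGroup Z] [Module R Z] [AddCommGroup W] [Module R W] [AddCommGroup X'] [Module R X']
  [AddCommGroup Y'] [Module R Y'] [AddCommGroup Z'] [Module R Z']
  {x r : R} {f : X →ₗ[R] Y} {g : Y →ₗ[R] Z} {h : Z →ₗ[R] X}
  {f' : X' →ₗ[R] Y'} {g' : Y' →ₗ[R] Z'} {h' : Z' →ₗ[R] X'}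

/-- Completion of a morphism of triangles, with prescribed values on the part of the basis of
`Z` that belongs to the noncontractible summands. -/
theorem TriNF.exists_fill {A B C K : Type u} {bX : Module.Basis (A ⊕ B ⊕ K) R X}
    {bY : Module.Basis (A ⊕ B ⊕ C) R Y} {bZ : Module.Basis (B ⊕ C ⊕ K) R Z}
    (N : TriNF x r bX bY bZ f g h) (fg' : Function.Exact f' g') (gh' : Function.Exact g' h')
    (hf' : Function.Exact h' f') (α : X →ₗ[R] X') (β : Y →ₗ[R] Y')
    (hαβ : ∀ v, β (f v) = f' (α v)) (z : B → Z')
    (hz : ∀ b, g' (β (bY (Sum.inr (Sum.inl b)))) = x • z b)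
    (hz' : ∀ b, h' (z b) = (x * r) • α (bX (Sum.inr (Sum.inl b)))) :
    ∃ γ : Z →ₗ[R] Z', (∀ y, γ (g y) = g' (β y)) ∧ (∀ t, h' (γ t) = α (h t)) ∧
      ∀ b, γ (bZ (Sum.inl b)) = z b := by
  have hk : ∀ k, ∃ t, h' t = α (bX (Sum.inr (Sum.inr k))) := fun k =>
    (hf' _).1 (by rw [← hαβ, N.fk, map_zero])
  choose zk hzk using hk
  let γ := bZ.constr ℕ (Sum.elim z (Sum.elim (fun c => g' (β (bY (Sum.inr (Sum.inr c))))) zk))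
  have hb : ∀ b, γ (bZ (Sum.inl b)) = z b := fun b => bZ.constr_basis ..
  have hc : ∀ c, γ (bZ (Sum.inr (Sum.inl c))) = g' (β (bY (Sum.inr (Sum.inr c)))) := fun c =>
    bZ.constr_basis ..
  have hk : ∀ k, γ (bZ (Sum.inr (Sum.inr k))) = zk k := fun k => bZ.constr_basis ..
  refine ⟨γ, LinearMap.congr_fun (f := γ ∘ₗ g) (g := g' ∘ₗ β) (bY.ext ?_),
    LinearMap.congr_fun (f := h' ∘ₗ γ) (g := α ∘ₗ h) (bZ.ext ?_), hb⟩
  · rintro (a | b | c) <;> simp only [LinearMap.comp_apply]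
    · rw [N.ga, map_zero, ← N.fa, hαβ, fg'.apply_apply_eq_zero]
    · rw [N.gb, map_smul, hb, hz]
    · rw [N.gc, hc]
  · rintro (b | c | k) <;> simp only [LinearMap.comp_apply]
    · rw [hb, hz', N.hb, map_smul]
    · rw [hc, N.hc, map_zero, gh'.apply_apply_eq_zero]
    · rw [hk, hzk, N.hk]

namespace ETri

/-- Signs do not affect images or kernels, and they disappear from multiples of `x` because `2x =
0`. -/
theorem neg₃ (S : Setup x r) (E : ETri x r f g h) : ETri x r f g (-h) := by
  refine ⟨E.fg, fun z => ?_, fun v => ?_, fun hx v y hv => ?_⟩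
  · rw [LinearMap.neg_apply, neg_eq_zero, E.gh z]
  · rw [E.hf v]
    constructor
    · rintro ⟨z, rfl⟩; exact ⟨-z, by simp⟩
    · rintro ⟨z, rfl⟩; exact ⟨-z, by simp⟩
  · obtain ⟨z, hz, hz'⟩ := E.bock hx v y hv
    exact ⟨z, hz, by rw [LinearMap.neg_apply, hz', mul_smul, S.neg_smul_eq]⟩

theorem neg₂ (S : Setup x r) (E : ETri x r f g h) : ETri x r f (-g) h := by
  simpa using (E.of_equiv (.refl R X) (.refl R Y) (.neg R) (g' := -g) (h' := -h) (fun _ => rfl)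
    (fun _ => rfl) (fun z => by simp)).neg₃ S

theorem neg₁ (S : Setup x r) (E : ETri x r f g h) : ETri x r (-f) g h := by
  simpa using (E.of_equiv (.neg R) (.refl R Y) (.refl R Z) (f' := -f) (h' := -h) (fun v => by simp)
    (fun _ => rfl) (fun z => by simp)).neg₃ S

theorem rotate [IsLocalRing R] [Module.Projective R Z] (S : Setup x r) (E : ETri x r f g h) :
    ETri x r g h (-f) := by
  refine ⟨E.gh, fun v => ?_, fun y => ?_, fun hx y₀ z₀ hy => ?_⟩
  · rw [LinearMap.neg_apply, neg_eq_zero, E.hf v]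
  · rw [E.fg y]
    constructor
    · rintro ⟨z, rfl⟩; exact ⟨-z, by simp⟩
    · rintro ⟨z, rfl⟩; exact ⟨-z, by simp⟩
  -- As `g` kills `x y₀`, this element is some `f v`. The original condition for `v` and `y₀` gives
  -- a `z` that differs from `z₀` by a multiple `x z'`, and `r v - h z'` is the element sought.
  · obtain ⟨v, hv⟩ := (E.fg (x • y₀)).1 (by rw [map_smul, hy, S.smul_smul_self])
    obtain ⟨z, hz, hz'⟩ := E.bock hx v y₀ hv
    obtain ⟨z', hz''⟩ := S.mem_rad_of_smul_eq_zero hx (y := z - z₀) (by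
      rw [smul_sub, ← hz, hy, sub_self])
    have hz₀ : z₀ = z - x • z' := by rw [← hz'', sub_sub_cancel]
    refine ⟨r • v - h z', ?_, ?_⟩
    · rw [hz₀, map_sub, hz', map_smul, smul_sub, smul_smul]
    · rw [LinearMap.neg_apply, map_sub, E.hf.apply_apply_eq_zero, sub_zero, map_smul, hv,
        smul_smul, ← S.comm, mul_smul, S.neg_smul_eq]

/-- Rotation has order three up to signs, so two further rotations undo one. -/
theorem unrotate [IsLocalRing R] [Module.Projective R X] [Module.Projective R Y] (S : Setup x r)
    (E : ETri x r g h (-f)) : ETri x r f g h := by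
  have h1 := (((E.rotate S).rotate S).neg₁ S).neg₂ S |>.neg₃ S
  simpa using h1

theorem contractible (X : Type u) [AddCommGroup X] [Module R X] (Z : Type u) [AddCommGroup Z]
    [Module R Z] [Subsingleton Z] (S : Setup x r) :
    ETri x r (LinearMap.id : X →ₗ[R] X) (0 : X →ₗ[R] Z) (0 : Z →ₗ[R] X) := by
  refine ⟨fun y => ?_, fun z => ?_, fun v => ?_, fun _ v y hv => ⟨0, Subsingleton.elim _ _, ?_⟩⟩
  · simp
  · simp [Subsingleton.elim z 0]
  · simp [eq_comm]
  · rw [LinearMap.id_apply] at hv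
    rw [map_zero, S.comm, mul_smul, hv, S.smul_smul_self, smul_zero]

end ETri

/-- Elements on which the last condition of `ETri` holds. -/
def Setup.bockSub (S : Setup x r) (f : X →ₗ[R] Y) (g : Y →ₗ[R] Z) (h : Z →ₗ[R] X) :
    Submodule R X where
  carrier := {v | ∃ y z, f v = x • y ∧ g y = x • z ∧ h z = (x * r) • v}
  zero_mem' := ⟨0, 0, by simp⟩
  add_mem' := by
    rintro v v' ⟨y, z, h1, h2, h3⟩ ⟨y', z', h1', h2', h3'⟩
    exact ⟨y + y', z + z', by simp [h1, h1'], by simp [h2, h2'], by simp [h3, h3']⟩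
  smul_mem' := by
    rintro c v ⟨y, z, h1, h2, h3⟩
    obtain ⟨c₁, hc₁⟩ := S.exists_right c
    obtain ⟨c₂, hc₂⟩ := S.exists_right c₁
    obtain ⟨c₃, hc₃⟩ := S.exists_right c₂
    refine ⟨c₁ • y, c₂ • z, ?_, ?_, ?_⟩
    · rw [map_smul, h1, smul_smul, smul_smul, hc₁]
    · rw [map_smul, h2, smul_smul, smul_smul, hc₂]
    · rw [map_smul, h3, smul_smul, smul_smul, ← mul_assoc, hc₃, mul_assoc,
        -- A scalar is moved across `x` three times on its way around the triangle; `cube` closes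
        -- the loop.
        S.cube c c₁ c₂ c₃ hc₁ hc₂ hc₃, mul_assoc]

/-- Two choices of `y` differ by some `x y'`, and adding `g y'` to `z` compensates without changing
`h z`. Hence the Bockstein condition may be verified for one `y` only, and on generators `v`. -/
theorem Setup.exists_of_mem_bockSub [IsLocalRing R] [Module.Projective R Y] (S : Setup x r)
    (hx : x ≠ 0) (gh : Function.Exact g h) {v : X} (hv : v ∈ S.bockSub f g h) {y : Y}
    (hy : f v = x • y) : ∃ z, g y = x • z ∧ h z = (x * r) • v := by
  obtain ⟨y₀, z₀, h1, h2, h3⟩ := hv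
  obtain ⟨y', hy'⟩ := S.mem_rad_of_smul_eq_zero hx (y := y - y₀) (by
    rw [smul_sub, ← h1, hy, sub_self])
  refine ⟨z₀ + g y', ?_, ?_⟩
  · rw [smul_add, ← h2, ← map_smul, ← hy', ← map_add, add_sub_cancel]
  · rw [map_add, h3, gh.apply_apply_eq_zero, add_zero]

/-- Every map in normal form can be completed to a triangle in normal form. -/
theorem MapNF.exists_triNF {A B C K : Type u} {bX : Module.Basis (A ⊕ B ⊕ K) R X}
    {bY : Module.Basis (A ⊕ B ⊕ C) R Y} (N : MapNF x bX bY f) (r : R) :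
    ∃ (g : Y →ₗ[R] (B ⊕ C ⊕ K →₀ R)) (h : (B ⊕ C ⊕ K →₀ R) →ₗ[R] X),
      TriNF x r bX bY Finsupp.basisSingleOne f g h := by
  let bZ : Module.Basis (B ⊕ C ⊕ K) R (B ⊕ C ⊕ K →₀ R) := Finsupp.basisSingleOne
  refine ⟨bY.constr ℕ (Sum.elim (fun _ => 0) (Sum.elim (fun b => x • bZ (Sum.inl b))
    fun c => bZ (Sum.inr (Sum.inl c)))), bZ.constr ℕ (Sum.elim
    (fun b => (x * r) • bX (Sum.inr (Sum.inl b))) (Sum.elim (fun _ => 0)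
    fun k => bX (Sum.inr (Sum.inr k)))), N, ?_, ?_, ?_, ?_, ?_, ?_⟩
  · exact fun a => bY.constr_basis ..
  · exact fun b => bY.constr_basis ..
  · exact fun c => bY.constr_basis ..
  · exact fun b => bZ.constr_basis ..
  · exact fun c => bZ.constr_basis ..
  · exact fun k => bZ.constr_basis ..

namespace Setup

variable [IsLocalRing R] (S : Setup x r)
include S

/-- A triangle has a normal form, compatible with a second map `q` into its second term. -/
theorem exists_triNF [Module.Projective R X] [Module.Projective R Y] (E : ETri x r f g h)
    (q : W →ₗ[R] Y) :
    ∃ (A B C K : Type u) (bX : Module.Basis (A ⊕ B ⊕ K) R X) (bY : Module.Basis (A ⊕ B ⊕ C) R Y)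
      (bZ : Module.Basis (B ⊕ C ⊕ K) R Z) (s : Set B), TriNF x r bX bY bZ f g h ∧
      (∀ b ∈ s, ∃ w ξ, bY (Sum.inr (Sum.inl b)) = q w + f ξ) ∧
      ∀ w ξ (c : B →₀ R) y,
        q w = f ξ + Finsupp.linearCombination R (fun b => bY (Sum.inr (Sum.inl b))) c + x • y →
        ∀ b ∉ s, c b ∈ maxIdeal R := by
  obtain ⟨A, B, C, K, bX, bY, s, N, hs, hs'⟩ := S.exists_mapNF f q
  obtain ⟨g₀, h₀, N₀⟩ := N.exists_triNF r
  have E₀ := S.eTri_of_triNF N₀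
  -- The Bockstein condition supplies the images of the `B` part of the model cone; the map `γ`
  -- extending them is an isomorphism by the five lemma, since it covers the identities of `X` and
  -- `Y`.
  choose z hz hz' using fun b => E.bock (N.ne b) _ _ (N.fb b)
  obtain ⟨γ, h1, h2, hγ⟩ := N₀.exists_fill E.fg E.gh E.hf .id .id (fun _ => rfl) z hz hz'
  simp only [LinearMap.id_apply] at h1 h2
  have hinj : Function.Injective γ := by
    rw [injective_iff_map_eq_zero]
    intro t ht
    obtain ⟨y, rfl⟩ := (E₀.gh t).1 (by rw [← h2, ht, map_zero])
    obtain ⟨v, rfl⟩ := (E.fg y).1 (by rw [← h1, ht])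
    exact E₀.fg.apply_apply_eq_zero v
  have hsurj : Function.Surjective γ := by
    intro t
    obtain ⟨t₀, ht₀⟩ := (E₀.hf (h t)).1 (E.hf.apply_apply_eq_zero t)
    obtain ⟨y, hy⟩ := (E.gh (t - γ t₀)).1 (by rw [map_sub, h2, ht₀, sub_self])
    exact ⟨t₀ + g₀ y, by rw [map_add, h1, hy, add_sub_cancel]⟩
  let e := LinearEquiv.ofBijective γ ⟨hinj, hsurj⟩
  have he : ∀ i, (Finsupp.basisSingleOne.map e) i = γ (Finsupp.basisSingleOne i) := fun i => rfl
  refine ⟨A, B, C, K, bX, bY, Finsupp.basisSingleOne.map e, s, ⟨N, ?_, ?_, ?_, ?_, ?_, ?_⟩,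
    hs, hs'⟩
  · intro a; rw [← h1, N₀.ga, map_zero]
  · intro b; rw [← h1, N₀.gb, he, map_smul]
  · intro c; rw [← h1, N₀.gc, he]
  · intro b; rw [he, h2, N₀.hb]
  · intro c; rw [he, h2, N₀.hc]
  · intro k; rw [he, h2, N₀.hk]

theorem exists_complete [Module.Projective R X] [Module.Projective R Y] (E : ETri x r f g h)
    (E' : ETri x r f' g' h') (α : X →ₗ[R] X') (β : Y →ₗ[R] Y') (hαβ : ∀ v, β (f v) = f' (α v)) :
    ∃ γ : Z →ₗ[R] Z', (∀ y, γ (g y) = g' (β y)) ∧ (∀ t, h' (γ t) = α (h t)) := by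
  obtain ⟨A, B, C, K, bX, bY, bZ, -, N, -⟩ := S.exists_triNF E (0 : X →ₗ[R] Y)
  have hb : ∀ b, ∃ z, g' (β (bY (Sum.inr (Sum.inl b)))) = x • z ∧
      h' z = (x * r) • α (bX (Sum.inr (Sum.inl b))) := fun b =>
    E'.bock (N.ne b) _ _ (by rw [← hαβ, N.fb, map_smul])
  choose z hz hz' using hb
  obtain ⟨γ, h1, h2, -⟩ := N.exists_fill E'.fg E'.gh E'.hf α β hαβ z hz hz'
  exact ⟨γ, h1, h2⟩

end Setup

/-- The map `g` preserves the coordinates along `C`, so these lie in `𝔪` for such a `y` and can be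
absorbed into `x y'`; the `A` part is in the image of `f`. -/
theorem TriNF.exists_eq_of_map_eq_smul (S : Setup x r) {A B C K : Type u}
    {bX : Module.Basis (A ⊕ B ⊕ K) R X} {bY : Module.Basis (A ⊕ B ⊕ C) R Y}
    {bZ : Module.Basis (B ⊕ C ⊕ K) R Z} (N : TriNF x r bX bY bZ f g h) {y : Y} {z : Z}
    (hy : g y = x • z) :
    ∃ ξ c y', y = f ξ + Finsupp.linearCombination R (fun b => bY (Sum.inr (Sum.inl b))) c +
      x • y' := by
  have hcoord : ∀ y c, bZ.repr (g y) (Sum.inr (Sum.inl c)) = bY.repr y (Sum.inr (Sum.inr c)) := by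
    intro y c
    refine LinearMap.congr_fun (f := bZ.coord (Sum.inr (Sum.inl c)) ∘ₗ g)
      (g := bY.coord (Sum.inr (Sum.inr c))) (bY.ext ?_) y
    classical
    rintro (a | b | c')
    · simp [N.ga]
    · simp [N.gb]
    · simp [N.gc, Finsupp.single_apply]
  have hbY : (bY : A ⊕ B ⊕ C → Y) = Sum.elim (fun a => bY (Sum.inl a))
      (Sum.elim (fun b => bY (Sum.inr (Sum.inl b))) fun c => bY (Sum.inr (Sum.inr c))) := by
    funext i
    rcases i with a | b | c <;> rfl
  have h1 := bY.linearCombination_repr y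
  rw [hbY, linearCombination_sumElim, linearCombination_sumElim] at h1
  set c₁ := (Finsupp.sumFinsuppEquivProdFinsupp (bY.repr y)).1
  set c₂ := (Finsupp.sumFinsuppEquivProdFinsupp
    (Finsupp.sumFinsuppEquivProdFinsupp (bY.repr y)).2).1
  set c₃ := (Finsupp.sumFinsuppEquivProdFinsupp
    (Finsupp.sumFinsuppEquivProdFinsupp (bY.repr y)).2).2 with hc₃
  have h2 : ∀ c, c₃ c ∈ maxIdeal R := by
    intro c
    rw [hc₃, Finsupp.snd_sumFinsuppEquivProdFinsupp, Finsupp.snd_sumFinsuppEquivProdFinsupp,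
      ← hcoord, hy, map_smul, Finsupp.smul_apply, smul_eq_mul]
    exact Ideal.mul_mem_right _ _ S.mem
  obtain ⟨c', hc'⟩ := S.exists_eq_smul_of_coeff_mem c₃ h2
  refine ⟨Finsupp.linearCombination R (fun a => bX (Sum.inl a)) c₁, c₂, Finsupp.linearCombination R
    (fun c => bY (Sum.inr (Sum.inr c))) c', ?_⟩
  rw [Finsupp.apply_linearCombination, ← map_smul, ← hc', add_assoc]
  have h3 : (f ∘ fun a => bX (Sum.inl a)) = fun a => bY (Sum.inl a) := funext N.fa
  rw [h3, h1]

namespace Setup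

variable [IsLocalRing R] (S : Setup x r)
include S

/-- The octahedral axiom for a map `p` and the inclusion of its source into `X × W`. -/
theorem exists_coneMap {Z₂ : Type u} [AddCommGroup Z₂] [Module R Z₂]
    [Module.Projective R X] [Module.Projective R Y] [Module.Projective R Z]
    (E : ETri x r f g h) (q : W →ₗ[R] Y) {g₂ : Y →ₗ[R] Z₂} {h₂ : Z₂ →ₗ[R] X × W}
    (E₂ : ETri x r (f.coprod q) g₂ h₂) :
    ∃ γ : Z →ₗ[R] Z₂, (∀ y, γ (g y) = g₂ y) ∧ (∀ z, h₂ (γ z) = (h z, 0)) ∧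
      ETri x r (g ∘ₗ q) γ (LinearMap.snd R X W ∘ₗ h₂) := by
  classical
  obtain ⟨A, B, C, K, bX, bY, bZ, s, N, hs, hs'⟩ := S.exists_triNF E q
  choose! w ξ hwξ using hs
  -- For `b ∈ s` the vector `bY b` equals `q w + f ξ`, so `f` sends `bX b - x ξ` to `x q w`, and the
  -- displayed pair is in the kernel of `f.coprod q`.
  have hker : ∀ b ∈ s, ∃ t, h₂ t = (bX (Sum.inr (Sum.inl b)) - x • ξ b, -(x • w b)) := by
    intro b hb
    refine (E₂.hf _).1 ?_
    rw [LinearMap.coprod_apply, map_sub, N.fb, map_smul, map_neg, map_smul, hwξ b hb, smul_add]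
    abel
  choose! t ht using hker
  -- Any fill-in gives an exact triangle. For `b ∈ s` the value is chosen as `x r t`, so that `γ (bZ
  -- b)` is divisible by `x`, as the Bockstein condition at `w b` requires.
  have hz : ∀ b, ∃ z, g₂ (bY (Sum.inr (Sum.inl b))) = x • z ∧
      h₂ z = (x * r) • (bX (Sum.inr (Sum.inl b)), (0 : W)) ∧ (b ∈ s → z = x • r • t b) := by
    intro b
    by_cases hb : b ∈ s
    · refine ⟨x • r • t b, ?_, ?_, fun _ => rfl⟩
      · rw [S.smul_smul_self, hwξ b hb]
        have := E₂.fg.apply_apply_eq_zero (ξ b, w b)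
        rwa [LinearMap.coprod_apply, add_comm] at this
      · rw [map_smul, map_smul, ht b hb, smul_smul, S.comm, mul_smul, mul_smul]
        simp only [Prod.smul_mk, smul_sub, smul_neg, S.smul_smul_self, sub_zero, smul_zero,
          neg_zero]
    · obtain ⟨z, h1, h2⟩ := E₂.bock (N.ne b) (bX (Sum.inr (Sum.inl b)), (0 : W))
        (bY (Sum.inr (Sum.inl b))) (by rw [LinearMap.coprod_apply, map_zero, add_zero, N.fb])
      exact ⟨z, h1, h2, fun h => absurd h hb⟩
  choose z hz₁ hz₂ hz₃ using hz
  obtain ⟨γ, hγ₁, hγ₂, hγ₃⟩ := N.exists_fill E₂.fg E₂.gh E₂.hf (LinearMap.inl R X W) .id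
    (fun v => by simp) z hz₁ hz₂
  simp only [LinearMap.id_apply, LinearMap.inl_apply] at hγ₁ hγ₂
  have hf₀ : ∀ v, g₂ (f v) = 0 := fun v => by simpa using E₂.fg.apply_apply_eq_zero (v, (0 : W))
  have hq₀ : ∀ v, g₂ (q v) = 0 := fun v => by simpa using E₂.fg.apply_apply_eq_zero ((0 : X), v)
  have ex₁ : Function.Exact (g ∘ₗ q) γ := by
    intro y
    constructor
    · intro hy
      have h1 := hγ₂ y
      rw [hy, map_zero] at h1
      obtain ⟨y', rfl⟩ := (E.gh y).1 (Prod.ext_iff.1 h1).1.symm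
      obtain ⟨⟨v, w'⟩, rfl⟩ := (E₂.fg y').1 (by rw [← hγ₁, hy])
      exact ⟨w', by simp [E.fg.apply_apply_eq_zero]⟩
    · rintro ⟨v, rfl⟩
      rw [LinearMap.comp_apply, hγ₁, hq₀]
  have ex₂ : Function.Exact γ (LinearMap.snd R X W ∘ₗ h₂) := by
    intro y
    constructor
    · intro hy
      have h1 : f (h₂ y).1 = 0 := by
        have h2 := E₂.hf.apply_apply_eq_zero y
        have h3 : (h₂ y).2 = 0 := hy
        rwa [LinearMap.coprod_apply, h3, map_zero, add_zero] at h2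
      obtain ⟨t', ht'⟩ := (E.hf _).1 h1
      obtain ⟨y', hy'⟩ := (E₂.gh (y - γ t')).1 (by
        rw [map_sub, hγ₂, ht']
        exact Prod.ext (sub_self _) (by simpa using hy))
      exact ⟨t' + g y', by rw [map_add, hγ₁, hy', add_sub_cancel]⟩
    · rintro ⟨v, rfl⟩
      rw [LinearMap.comp_apply, hγ₂, LinearMap.snd_apply]
  have ex₃ : Function.Exact (LinearMap.snd R X W ∘ₗ h₂) (g ∘ₗ q) := by
    intro v
    constructor
    · intro hv
      obtain ⟨v', hv'⟩ := (E.fg (q v)).1 hv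
      obtain ⟨t', ht'⟩ := (E₂.hf (-v', v)).1 (by simp [hv'])
      exact ⟨t', by simp [ht']⟩
    · rintro ⟨y, rfl⟩
      have h1 := E₂.hf.apply_apply_eq_zero y
      rw [LinearMap.coprod_apply] at h1
      simp [eq_neg_of_add_eq_zero_right h1, E.fg.apply_apply_eq_zero]
  refine ⟨γ, hγ₁, hγ₂, ex₁, ex₂, ex₃, fun hx w₀ z₀ hw₀ => ?_⟩
  refine S.exists_of_mem_bockSub hx ex₂ ?_ hw₀
  have good₁ : ∀ b ∈ s, w b ∈ S.bockSub (g ∘ₗ q) γ (LinearMap.snd R X W ∘ₗ h₂) := by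
    intro b hb
    refine ⟨bZ (Sum.inl b), r • t b, ?_, by rw [hγ₃, hz₃ b hb], ?_⟩
    · rw [← N.gb, hwξ b hb, map_add, E.fg.apply_apply_eq_zero, add_zero, LinearMap.comp_apply]
    · rw [map_smul, LinearMap.comp_apply, ht b hb, LinearMap.snd_apply, S.neg_smul_eq, smul_smul,
        S.comm]
  -- On these elements the condition is inherited from the triangle on `f.coprod q`, applied to
  -- `(-ξ', w')`.
  have good₂ : ∀ w' ξ' y', q w' = f ξ' + x • y' →
      w' ∈ S.bockSub (g ∘ₗ q) γ (LinearMap.snd R X W ∘ₗ h₂) := by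
    intro w' ξ' y' hw'
    obtain ⟨z', h1, h2⟩ := E₂.bock hx (-ξ', w') y' (by simp [hw'])
    refine ⟨g y', z', ?_, by rw [hγ₁, h1], ?_⟩
    · rw [LinearMap.comp_apply, hw', map_add, E.fg.apply_apply_eq_zero, zero_add, map_smul]
    · rw [LinearMap.comp_apply, h2]
      rfl
  obtain ⟨ξ₀, c, y', hc⟩ := N.exists_eq_of_map_eq_smul S (y := q w₀) hw₀
  have hcs := hs' w₀ ξ₀ c y' hc
  -- The coefficients outside `s` lie in `𝔪`, so they contribute a multiple of `x`. Subtracting from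
  -- `w₀` the combination of the `w b` with `b ∈ s` thus leaves an element covered by `good₂`.
  let c₁ := c.filter (· ∈ s)
  obtain ⟨c₂, hc₂⟩ := S.exists_eq_smul_of_coeff_mem (c.filter (· ∉ s)) fun b => by
    by_cases hb : b ∈ s
    · rw [Finsupp.filter_apply, if_neg (not_not.2 hb)]
      exact zero_mem _
    · rw [Finsupp.filter_apply, if_pos hb]
      exact hcs b hb
  have hsum : Finsupp.linearCombination R (fun b => bY (Sum.inr (Sum.inl b))) c₁ =
      q (Finsupp.linearCombination R w c₁) + f (Finsupp.linearCombination R ξ c₁) := by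
    rw [Finsupp.apply_linearCombination, Finsupp.apply_linearCombination,
      Finsupp.linearCombination_apply, Finsupp.linearCombination_apply,
      Finsupp.linearCombination_apply, ← Finsupp.sum_add]
    refine Finsupp.sum_congr fun b hb => ?_
    rw [Finsupp.support_filter, Finset.mem_filter] at hb
    rw [hwξ b hb.2, smul_add]
    rfl
  rw [← Finsupp.filter_add_filter_not c (· ∈ s), map_add, hc₂, map_smul] at hc
  rw [← sub_add_cancel w₀ (Finsupp.linearCombination R w c₁)]
  refine Submodule.add_mem _ (good₂ _ (ξ₀ + Finsupp.linearCombination R ξ c₁)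
    (Finsupp.linearCombination R (fun b => bY (Sum.inr (Sum.inl b))) c₂ + y') ?_)
    (Submodule.sum_mem _ fun b hb => Submodule.smul_mem _ _ (good₁ b ?_))
  · rw [map_sub, hc]
    change f ξ₀ + (Finsupp.linearCombination R _ c₁ + _) + _ - _ = _
    rw [hsum, map_add, smul_add]
    abel
  · rw [Finsupp.support_filter, Finset.mem_filter] at hb
    exact hb.2

end Setup

end Axioms

/-! ### The general octahedral axiom -/

section Octahedra

variable {R : Type u} [Ring R] {x r : R}
  {X₁ X₂ X₃ Z₁₂ Z₂₃ Z₁₃ : Type u} [AddCommGroup X₁] [Module R X₁] [AddCommGroup X₂] [Module R X₂]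
  [AddCommGroup X₃] [Module R X₃] [AddCommGroup Z₁₂] [Module R Z₁₂] [AddCommGroup Z₂₃]
  [Module R Z₂₃] [AddCommGroup Z₁₃] [Module R Z₁₃]

/-- After the automorphism `(a, b) ↦ (a, u₁₂ a + b)` of `X₁ × X₂`, this is the given triangle plus
the contractible triangle `X₁ → 0 → X₁`. -/
theorem ETri.coprod_comp (S : Setup x r) {u₂₃ : X₂ →ₗ[R] X₃} {v₂₃ : X₃ →ₗ[R] Z₂₃}
    {w₂₃ : Z₂₃ →ₗ[R] X₂} (E : ETri x r u₂₃ v₂₃ w₂₃) (u₁₂ : X₁ →ₗ[R] X₂) :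
    ETri x r ((u₂₃ ∘ₗ u₁₂).coprod u₂₃) (LinearMap.inl R Z₂₃ X₁ ∘ₗ v₂₃)
      ((LinearMap.snd R Z₂₃ X₁).prod (w₂₃.coprod (-u₁₂))) := by
  refine ⟨fun y => ?_, fun z => ?_, fun p => ?_, fun hx p y hp => ?_⟩
  · constructor
    · intro hy
      obtain ⟨v, rfl⟩ := (E.fg y).1 (Prod.ext_iff.1 hy).1
      exact ⟨(0, v), by simp⟩
    · rintro ⟨p, rfl⟩
      simp [E.fg.apply_apply_eq_zero]
  · constructor
    · intro hz
      have h1 : z.2 = 0 := (Prod.ext_iff.1 hz).1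
      have h2 : w₂₃ z.1 = 0 := by simpa [h1] using (Prod.ext_iff.1 hz).2
      obtain ⟨y, hy⟩ := (E.gh _).1 h2
      exact ⟨y, Prod.ext hy h1.symm⟩
    · rintro ⟨y, rfl⟩
      simp [E.gh.apply_apply_eq_zero]
  · constructor
    · intro hp
      obtain ⟨z, hz⟩ := (E.hf (u₁₂ p.1 + p.2)).1 (by simpa using hp)
      exact ⟨(z, p.1), Prod.ext rfl (by simp [hz])⟩
    · rintro ⟨z, rfl⟩
      simp [E.hf.apply_apply_eq_zero]
  · obtain ⟨z, hz, hz'⟩ := E.bock hx (u₁₂ p.1 + p.2) y (by simpa using hp)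
    refine ⟨(z, (x * r) • p.1), Prod.ext hz ?_, Prod.ext rfl ?_⟩
    · simp [mul_smul, S.smul_smul_self]
    · simp [hz']

/-- A first cone map, for `u₂₃ ∘ u₁₂` and `u₂₃`, yields a triangle `X₂ → Z₁₃ → Z₂₃ × X₁ → X₂`.
Rotated, it presents `Z₁₃` as a cone of `X₁ × Z₂₃ → X₂`, so a second cone map, for `u₁₂` and `w₂₃`,
applies and gives the wanted triangle up to rotation. -/
theorem Setup.exists_octahedron [IsLocalRing R] [Module.Projective R X₁] [Module.Projective R X₂]
    [Module.Projective R X₃] [Module.Projective R Z₁₂] [Module.Projective R Z₂₃]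
    [Module.Projective R Z₁₃] (S : Setup x r)
    {u₁₂ : X₁ →ₗ[R] X₂} {v₁₂ : X₂ →ₗ[R] Z₁₂} {w₁₂ : Z₁₂ →ₗ[R] X₁} (E₁₂ : ETri x r u₁₂ v₁₂ w₁₂)
    {u₂₃ : X₂ →ₗ[R] X₃} {v₂₃ : X₃ →ₗ[R] Z₂₃} {w₂₃ : Z₂₃ →ₗ[R] X₂} (E₂₃ : ETri x r u₂₃ v₂₃ w₂₃)
    {v₁₃ : X₃ →ₗ[R] Z₁₃} {w₁₃ : Z₁₃ →ₗ[R] X₁} (E₁₃ : ETri x r (u₂₃ ∘ₗ u₁₂) v₁₃ w₁₃) :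
    ∃ (m₁ : Z₁₂ →ₗ[R] Z₁₃) (m₃ : Z₁₃ →ₗ[R] Z₂₃), (∀ y, m₁ (v₁₂ y) = v₁₃ (u₂₃ y)) ∧
      (∀ z, w₁₃ (m₁ z) = w₁₂ z) ∧ (∀ y, m₃ (v₁₃ y) = v₂₃ y) ∧
      (∀ z, u₁₂ (w₁₃ z) = w₂₃ (m₃ z)) ∧ ETri x r m₁ m₃ (v₁₂ ∘ₗ w₂₃) := by
  obtain ⟨γ, h1, h2, E⟩ := S.exists_coneMap E₁₃ u₂₃ (E₂₃.coprod_comp S u₁₂)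
  have h3 : ∀ z, (γ z).2 = w₁₃ z := fun z => (Prod.ext_iff.1 (h2 z)).1
  have h4 : ∀ z, w₂₃ (γ z).1 = u₁₂ (w₁₃ z) := fun z => by
    have : w₂₃ (γ z).1 + -(u₁₂ (γ z).2) = 0 := (Prod.ext_iff.1 (h2 z)).2
    rw [h3] at this
    exact add_neg_eq_zero.1 this
  -- The sign on `X₁` turns the map `(z, a) ↦ w₂₃ z - u₁₂ a` into `u₁₂.coprod w₂₃`.
  let e : (Z₂₃ × X₁) ≃ₗ[R] (X₁ × Z₂₃) :=
    (LinearEquiv.prodComm R Z₂₃ X₁).trans ((LinearEquiv.neg R).prodCongr (.refl R Z₂₃))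
  have E' : ETri x r (u₁₂.coprod w₂₃) (v₁₃ ∘ₗ u₂₃) (w₁₃.prod (-(LinearMap.fst R Z₂₃ X₁ ∘ₗ γ))) := by
    have := ((((E.rotate S).rotate S).neg₂ S).of_equiv e (.refl R X₂) (.refl R Z₁₃)
      (f' := u₁₂.coprod w₂₃) (g' := v₁₃ ∘ₗ u₂₃)
      (h' := w₁₃.prod (-(LinearMap.fst R Z₂₃ X₁ ∘ₗ γ))) ?_ ?_ ?_)
    · exact this
    · rintro ⟨z, a⟩
      simp [e, add_comm]
    · intro y
      simp
    · intro z
      simp [e, h3]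
  obtain ⟨m₁, h5, h6, E''⟩ := S.exists_coneMap E₁₂ w₂₃ E'
  refine ⟨m₁, LinearMap.fst R Z₂₃ X₁ ∘ₗ γ, h5, fun z => (Prod.ext_iff.1 (h6 z)).1,
    fun y => by simp [h1], fun z => (h4 z).symm, ?_⟩
  have := ((E''.rotate S).neg₂ S).neg₃ S
  rw [LinearMap.snd_prod] at this
  simpa using this

end Octahedra

/-! ### Assembling the triangulations and identifying their triangles -/

section Existence

attribute [local instance] idShift

open ZeroObject

variable {R : Type u} [Ring R] [IsLocalRing R] {P : ObjectProperty (ModuleCat.{u} R)}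
  [P.ContainsZero] {x r : R}

/-- The triangles described by `ETri` form a triangulation. -/
theorem Setup.isTriangulation_eTriangles (S : Setup x r)
    (hP : ∀ M, P M → Module.Projective R M)
    (hcone : ∀ M N : ModuleCat.{u} R, P M → P N → ∀ A B C K : Type u,
      Module.Basis (A ⊕ B ⊕ K) R M → Module.Basis (A ⊕ B ⊕ C) R N →
      P (ModuleCat.of R (B ⊕ C ⊕ K →₀ R))) :
    IsTriangulation (eTriangles P x r) := by
  have proj : ∀ M : P.FullSubcategory, Module.Projective R M.obj := fun M => hP _ M.2
  let p : Pretriangulated P.FullSubcategory :=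
    { distinguishedTriangles := eTriangles P x r
      isomorphic_distinguished := fun T hT T' e => eTriangles_of_iso e.symm hT
      contractible_distinguished := fun X =>
        ETri.contractible X.obj (zeroObj P).obj S
      distinguished_cocone_triangle := fun {X Y} f => by
        obtain ⟨A, B, C, K, bX, bY, -, N, -⟩ := S.exists_mapNF (lin f) (0 : X.obj →ₗ[R] Y.obj)
        obtain ⟨g, h, N'⟩ := N.exists_triNF r
        let Z : P.FullSubcategory := ⟨ModuleCat.of R (B ⊕ C ⊕ K →₀ R),
          hcone _ _ X.2 Y.2 A B C K bX bY⟩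
        exact ⟨Z, ofLin (N := Z) g, ofLin (M := Z) (N := X) h, S.eTri_of_triNF N'⟩
      rotate_distinguished_triangle := fun T =>
        ⟨fun h => ETri.rotate S h, fun h => ETri.unrotate S h⟩
      complete_distinguished_triangle_morphism := fun T₁ T₂ h₁ h₂ a b hab => by
        obtain ⟨γ, hγ, hγ'⟩ := S.exists_complete h₁ h₂ (lin a) (lin b)
          (LinearMap.congr_fun (congrArg lin hab))
        exact ⟨ofLin γ, hom_ext_lin hγ, hom_ext_lin (N := T₂.obj₁) fun t => (hγ' t).symm⟩ }
  refine ⟨p, rfl, ⟨?_⟩⟩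
  intro X₁ X₂ X₃ Z₁₂ Z₂₃ Z₁₃ u₁₂ u₂₃ u₁₃ comm v₁₂ w₁₂ h₁₂ v₂₃ w₂₃ h₂₃ v₁₃ w₁₃ h₁₃
  subst comm
  obtain ⟨m₁, m₃, e₁, e₂, e₃, e₄, hm⟩ := S.exists_octahedron h₁₂ h₂₃ h₁₃
  exact ⟨⟨ofLin m₁, ofLin m₃, hom_ext_lin e₁, hom_ext_lin (N := X₁) e₂, hom_ext_lin e₃,
    hom_ext_lin (N := X₂) e₄, hm⟩⟩

theorem Setup.isTriangulation_eTriangles_isProj (S : Setup x r) :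
    IsTriangulation (eTriangles (isProj R) x r) :=
  S.isTriangulation_eTriangles (fun _ h => h) fun _ _ _ _ _ _ _ _ _ _ =>
    (inferInstance : Module.Projective R (_ →₀ R))

theorem Setup.isTriangulation_eTriangles_isFGProj (S : Setup x r) :
    IsTriangulation (eTriangles (isFGProj R) x r) :=
  S.isTriangulation_eTriangles (fun _ h => h.1) fun M N hM hN A B C K bX bY => by
    have := hM.2
    have := hN.2
    have := Module.Finite.finite_basis bX
    have := Module.Finite.finite_basis bY
    have : Finite (B ⊕ K) := Finite.of_injective (Sum.inr : _ → A ⊕ B ⊕ K) Sum.inr_injective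
    have : Finite (B ⊕ C) := Finite.of_injective (Sum.inr : _ → A ⊕ B ⊕ C) Sum.inr_injective
    have : Finite B := Finite.of_injective (Sum.inl : _ → B ⊕ C) Sum.inl_injective
    have : Finite C := Finite.of_injective (Sum.inr : _ → B ⊕ C) Sum.inr_injective
    have : Finite K := Finite.of_injective (Sum.inr : _ → B ⊕ K) Sum.inr_injective
    exact ⟨(inferInstance : Module.Projective R (_ →₀ R)),
      (inferInstance : Module.Finite R (_ →₀ R))⟩

/-- The class of triangles of the explicit construction. -/
theorem Setup.eTriangles_isProj (S : Setup x r) (hx : x ≠ 0) :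
    eTriangles (isProj R) x r = projTriangles x r := by
  ext T
  constructor
  · intro hT
    have : Module.Projective R T.obj₁.obj := T.obj₁.2
    have : Module.Projective R T.obj₂.obj := T.obj₂.2
    obtain ⟨A, B, C, K, bX, bY, bZ, -, N, -⟩ := S.exists_triNF hT (0 : R →ₗ[R] T.obj₂.obj)
    exact ⟨_, isSumOfContractibleOr_of_triNF (isProj_self R) N S.comm⟩
  · rintro ⟨ι, hT⟩
    exact S.eTriangles_of_sum hx (fun _ h => h) _ (fun M _ _ hM => projective_directSum M hM) hT

theorem Setup.eTriangles_isFGProj (S : Setup x r) (hx : x ≠ 0) :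
    eTriangles (isFGProj R) x r = fgProjTriangles x r := by
  ext T
  constructor
  · intro hT
    have : Module.Projective R T.obj₁.obj := T.obj₁.2.1
    have : Module.Projective R T.obj₂.obj := T.obj₂.2.1
    have := T.obj₁.2.2
    have := T.obj₂.2.2
    obtain ⟨A, B, C, K, bX, bY, bZ, -, N, -⟩ := S.exists_triNF hT (0 : R →ₗ[R] T.obj₂.obj)
    refine ⟨_, ?_, isSumOfContractibleOr_of_triNF (isFGProj_self R) N S.comm⟩
    have := Module.Finite.finite_basis bX
    have := Module.Finite.finite_basis bY
    -- Each summand is recorded by a basis vector of `X` or of `Y`, and both bases are finite.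
    exact Finite.of_injective (Sum.elim (Sum.inl ∘ Sum.inl) (Sum.elim (Sum.inl ∘ Sum.inr ∘ Sum.inl)
      (Sum.elim (Sum.inr ∘ Sum.inr ∘ Sum.inr) (Sum.inl ∘ Sum.inr ∘ Sum.inr))) :
        A ⊕ B ⊕ C ⊕ K → (A ⊕ B ⊕ K) ⊕ (A ⊕ B ⊕ C)) (by
      rintro (a | b | c | k) (a' | b' | c' | k') <;> simp)
  · rintro ⟨ι, hι, hT⟩
    refine S.eTriangles_of_sum hx (fun _ h => h.1) _ (fun M _ _ hM => ?_) hT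
    have : ∀ i, Module.Finite R (M i) := fun i => (hM i).2
    exact ⟨projective_directSum M fun i => (hM i).1,
      (inferInstance : Module.Finite R (DirectSum ι M))⟩

end Existence

/-! ### Admissible elements give instances of `Setup` -/

section Constructors

variable {R : Type u} [Ring R]

theorem setup_of_eq_bot (h : maxIdeal R = ⊥) : Setup (0 : R) 1 where
  mem := zero_mem _
  left a ha := ⟨0, by rw [h] at ha; rw [mul_zero]; exact ha⟩
  right a ha := ⟨0, by rw [h] at ha; rw [mul_zero]; exact ha⟩
  sq a ha b _ := by rw [h] at ha; rw [Ideal.mem_bot.1 ha, zero_mul]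
  ann h0 := absurd rfl h0
  comm := by simp
  unit := isUnit_one
  add_self := add_zero 0
  cube := by simp

theorem two_mem_of_maxIdealEqTwo (h : MaxIdealEqTwo R) : (2 : R) ∈ maxIdeal R := by
  have : (2 : R) ∈ (maxIdeal R : Set R) := by
    rw [h]
    exact ⟨1, mul_one 2⟩
  exact this

theorem two_ne_zero_of_maxIdealEqTwo (h : MaxIdealEqTwo R) (hb : maxIdeal R ≠ ⊥) : (2 : R) ≠ 0 := by
  intro h2
  refine hb ((Submodule.eq_bot_iff _).2 fun a ha => ?_)
  have h' : a ∈ (maxIdeal R : Set R) := ha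
  rw [h] at h'
  obtain ⟨c, rfl⟩ := h'
  simp [h2]

variable [IsLocalRing R]

theorem SquareZeroSimple.setup (hR : SquareZeroSimple R) {x r : R} (hx : x ∈ maxIdeal R)
    (hx0 : x ≠ 0) (h2 : (2 : R) ∈ maxIdeal R) (hr : IsTwist hR hx hx0 (res r)) : Setup x r where
  mem := hx
  left a ha := by
    have h : a ∈ (maxIdeal R : Set R) := ha
    rw [hR.eq_left x hx hx0] at h
    obtain ⟨c, hc⟩ := h
    exact ⟨c, hc.symm⟩
  right a ha := by
    have h : a ∈ (maxIdeal R : Set R) := ha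
    rw [hR.eq_right x hx hx0] at h
    obtain ⟨c, hc⟩ := h
    exact ⟨c, hc.symm⟩
  sq := hR.sq_zero
  ann _ c hc := (mem_maxIdeal_iff c).2 fun hu => hx0 ((hu.mul_left_eq_zero).1 hc)
  comm := by
    obtain ⟨s, hs⟩ := hR.exists_left hx hx0 r
    have h1 := (sigma_res hR hx hx0 hs).symm.trans hr.2.1
    rw [← sub_eq_zero, ← map_sub] at h1
    rw [hs, ← sub_eq_zero, ← sub_mul]
    exact hR.sq_zero _ (res_eq_zero_iff.1 h1) _ hx
  unit := by
    by_contra hu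
    exact hr.1 (res_eq_zero_iff.2 ((mem_maxIdeal_iff r).2 hu))
  add_self := by
    rw [← mul_two]
    exact hR.sq_zero _ hx _ h2
  cube c c₁ c₂ c₃ h₁ h₂ h₃ := by
    have h4 := hr.2.2 (res c₃)
    rw [sigma_res hR hx hx0 h₃.symm, sigma_res hR hx hx0 h₂.symm, sigma_res hR hx hx0 h₁.symm] at h4
    have h5 : res (c₃ * r) = res (r * c) := by
      change res c₃ * res r = res r * res c
      rw [h4, mul_assoc, mul_inv_cancel_left₀ hr.1]
    rw [← sub_eq_zero, ← map_sub] at h5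
    rw [← sub_eq_zero, ← mul_sub]
    exact hR.sq_zero _ hx _ (res_eq_zero_iff.1 h5)

/-- The element `2` is central in `R`, so its automorphism of `d` is trivial. -/
theorem sigma_two (hR : SquareZeroSimple R) (h2 : (2 : R) ∈ maxIdeal R) (h20 : (2 : R) ≠ 0)
    (t : Residue R) : sigma hR h2 h20 t = t := by
  obtain ⟨a, rfl⟩ := Ideal.Quotient.mk_surjective t
  exact sigma_res hR h2 h20 (by rw [two_mul, mul_two])

theorem isTwist_two (hR : SquareZeroSimple R) (h2 : (2 : R) ∈ maxIdeal R) (h20 : (2 : R) ≠ 0)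
    {c : Residue R} (hc : c ∈ Subring.center (Residue R)) (hc0 : c ≠ 0) :
    IsTwist hR h2 h20 c := by
  refine ⟨hc0, sigma_two hR h2 h20 c, fun t => ?_⟩
  rw [sigma_two, sigma_two, sigma_two, mul_assoc, Subring.mem_center_iff.1 hc t,
    inv_mul_cancel_left₀ hc0]

end Constructors

/-! ### Constraints imposed by a cone of `x` -/

section Necessity

variable {R : Type u} [Ring R] [IsLocalRing R]

/-- The consequences for the residue skew field of the existence of a triangle of the form
`x`, `ρ x`, `x` that maps to its rotation. -/
theorem SquareZeroSimple.isTwist_of_forall (hR : SquareZeroSimple R) {x ρ : R}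
    (hx : x ∈ maxIdeal R) (hx0 : x ≠ 0) (hρ : ρ * x ≠ 0)
    (H : ∀ a₁ a₂ : R, x * a₂ = a₁ * (ρ * x) →
      ∃ a₃, ρ * x * a₃ = a₂ * x ∧ x * a₁ = -(a₃ * x)) :
    (2 : R) ∈ maxIdeal R ∧ IsTwist hR hx hx0 (res ρ) := by
  set σ := sigma hR hx hx0 with hσ
  have hρ0 : res ρ ≠ 0 := fun h => hρ (hR.sq_zero _ (res_eq_zero_iff.1 h) _ hx)
  -- The hypothesis `H` is the completion of a morphism from the triangle `x`, `ρx`, `x` to its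
  -- rotation `ρx`, `x`, `-x`. Each of the three commuting squares expresses one application of `σ`,
  -- and the sign comes from the rotation.
  have key : ∀ t, σ (σ (σ t)) = -((res ρ)⁻¹ * t * σ (σ (res ρ))) := by
    intro t
    obtain ⟨a₂, rfl⟩ := Ideal.Quotient.mk_surjective t
    obtain ⟨a₁, h₁⟩ : ∃ a₁, x * a₂ = a₁ * (ρ * x) := by
      have h : x * a₂ ∈ (maxIdeal R : Set R) := Ideal.mul_mem_right _ _ hx
      rw [hR.eq_left (ρ * x) (Ideal.mul_mem_left _ _ hx) hρ] at h
      obtain ⟨a₁, h⟩ := h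
      exact ⟨a₁, h.symm⟩
    obtain ⟨a₃, h₂, h₃⟩ := H a₁ a₂ h₁
    obtain ⟨s, hs⟩ := hR.exists_left hx hx0 a₃
    have e₁ : σ (res a₂) = res a₁ * res ρ := by
      rw [← map_mul]
      exact sigma_res hR hx hx0 (by rw [h₁, mul_assoc])
    have e₂ : res ρ * σ (res a₃) = res a₂ := by
      rw [hσ, sigma_res hR hx hx0 hs, ← map_mul]
      exact res_eq_of_mul_eq hx0 (by rw [mul_assoc, ← hs, ← mul_assoc, h₂])
    have e₃ : σ (res a₁) = -res a₃ := by
      rw [← map_neg]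
      exact sigma_res hR hx hx0 (by rw [h₃, neg_mul])
    change σ (σ (σ (res a₂))) = -((res ρ)⁻¹ * res a₂ * σ (σ (res ρ)))
    rw [e₁, map_mul, e₃, map_mul, map_neg, neg_mul, ← e₂, inv_mul_cancel_left₀ hρ0]
  have h1 : σ (σ (res ρ)) = -res ρ := by
    have h := key 1
    rw [map_one, map_one, map_one, mul_one] at h
    have h' := congrArg (res ρ * ·) h
    simp only [mul_one, mul_neg, mul_inv_cancel_left₀ hρ0] at h'
    rw [eq_comm, neg_eq_iff_eq_neg]
    exact h'
  -- At `t = 1` the formula gave `σ²(ρ) = -ρ`; at `t = ρ` it gives `σ³(ρ) = ρ`. Comparison yields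
  -- `σ(ρ) = -ρ`, and applying `σ` again yields `ρ = -ρ`.
  have h2 : σ (res ρ) = -res ρ := by
    have h := key (res ρ)
    rw [h1, inv_mul_cancel₀ hρ0, one_mul, neg_neg, map_neg] at h
    rw [← h, neg_neg, h]
  have h3 : -res ρ = res ρ := by
    rw [← h1, h2, map_neg, h2, neg_neg]
  refine ⟨?_, hρ0, h2.trans h3, fun t => ?_⟩
  · rw [← res_eq_zero_iff]
    have h4 : res (2 : R) * res ρ = 0 := by
      have h5 : res (2 : R) = 2 := map_ofNat _ 2
      rw [h5, two_mul]
      nth_rewrite 1 [← h3]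
      exact neg_add_cancel _
    exact (mul_eq_zero.1 h4).resolve_right hρ0
  · rw [key, h1, mul_neg, neg_neg]

theorem SquareZeroSimple.caseCondition_of_isTwist (hR : SquareZeroSimple R) {x ρ : R}
    (hx : x ∈ maxIdeal R) (hx0 : x ≠ 0) (h2 : (2 : R) ∈ maxIdeal R)
    (h : IsTwist hR hx hx0 (res ρ)) : CaseCondition hR := by
  by_cases h20 : (2 : R) = 0
  · exact Or.inr (Or.inr ⟨by rw [one_add_one_eq_two, h20], x, hx, hx0, _, h⟩)
  · exact Or.inr (Or.inl (hR.eq_right 2 h2 h20))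

/-- If a projective module fits into an exact sequence `R → R → Z → R → R` whose outer maps are
the right multiplication by `x`, it is free of rank one. -/
theorem SquareZeroSimple.bijective_toSpanSingleton (hR : SquareZeroSimple R) {x : R}
    (hx : x ∈ maxIdeal R) (hx0 : x ≠ 0) {Z : Type u} [AddCommGroup Z] [Module R Z]
    [Module.Projective R Z] {g : R →ₗ[R] Z} {h : Z →ₗ[R] R}
    (fg : Function.Exact (LinearMap.toSpanSingleton R R x) g) (gh : Function.Exact g h)
    (hf : Function.Exact h (LinearMap.toSpanSingleton R R x)) {z₀ : Z} (hz₀ : h z₀ = x) :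
    Function.Bijective (LinearMap.toSpanSingleton R Z z₀) := by
  have ann : ∀ c : R, c * x = 0 → c ∈ maxIdeal R := fun c hc =>
    (mem_maxIdeal_iff c).2 fun hu => hx0 ((hu.mul_right_eq_zero).1 hc)
  have ann' : ∀ c : R, x * c = 0 → c ∈ maxIdeal R := fun c hc =>
    (mem_maxIdeal_iff c).2 fun hu => hx0 ((hu.mul_left_eq_zero).1 hc)
  have left : ∀ y ∈ maxIdeal R, y ≠ 0 → ∀ a ∈ maxIdeal R, ∃ c, c * y = a := by
    intro y hy hy0 a ha
    have h : a ∈ (maxIdeal R : Set R) := ha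
    rwa [hR.eq_left y hy hy0] at h
  have hmem : ∀ z, h z ∈ maxIdeal R := fun z => ann _ (hf.apply_apply_eq_zero z)
  obtain ⟨s, hs⟩ := Module.projective_def'.1 (inferInstance : Module.Projective R Z)
  -- `Z` embeds as a summand in a free module, where elements killed by `x` have coordinates in `𝔪`.
  have tors : ∀ z : Z, x • z = 0 → ∃ c : Z →₀ R, (∀ i, c i ∈ maxIdeal R) ∧
      z = Finsupp.linearCombination R id c := by
    intro z hz
    refine ⟨s z, fun i => ann' _ ?_, (LinearMap.congr_fun hs z).symm⟩
    have := DFunLike.congr_fun (congrArg s hz) i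
    simpa using this
  -- Otherwise `z₀` would lie in `𝔪 Z`; as `h` takes values in `𝔪`, this would give `x = h z₀ ∈ 𝔪² =
  -- 0`.
  have hxz₀ : x • z₀ ≠ 0 := by
    intro h0
    obtain ⟨c, hc, hz⟩ := tors z₀ h0
    refine hx0 ?_
    rw [← hz₀, hz, Finsupp.apply_linearCombination, Finsupp.linearCombination_apply]
    exact Finset.sum_eq_zero fun i _ => hR.sq_zero _ (hc i) _ (hmem i)
  have hxg : x • g 1 = 0 := by
    rw [← map_smul]
    exact (fg _).2 ⟨1, by simp⟩
  have hspan : ∀ z, ∃ c y : R, z = c • z₀ + y • g 1 := by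
    intro z
    obtain ⟨c, hc⟩ := left x hx hx0 _ (hmem z)
    obtain ⟨y, hy⟩ := (gh (z - c • z₀)).1 (by
      rw [map_sub, map_smul, hz₀, smul_eq_mul, hc, sub_self])
    refine ⟨c, y, ?_⟩
    rw [← map_smul, smul_eq_mul, mul_one, hy, add_sub_cancel]
  constructor
  · rw [← LinearMap.ker_eq_bot, LinearMap.ker_eq_bot']
    intro c hc
    by_contra hc0
    rw [LinearMap.toSpanSingleton_apply] at hc
    have hcm : c ∈ maxIdeal R := ann c (by
      have := congrArg h hc
      rwa [map_smul, hz₀, map_zero] at this)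
    obtain ⟨b, hb⟩ := left c hcm hc0 x hx
    exact hxz₀ (by rw [← hb, mul_smul, hc, smul_zero])
  · rw [← LinearMap.range_eq_top, LinearMap.range_toSpanSingleton, eq_top_iff]
    have hz : z₀ ∈ Submodule.span R {z₀} := Submodule.mem_span_singleton_self z₀
    -- `g 1` is a combination with coefficients in `𝔪` of elements `a z₀ + y g 1`; the `g 1` terms
    -- drop out because `𝔪 = Rx` kills `g 1`.
    have hg1 : g 1 ∈ Submodule.span R {z₀} := by
      obtain ⟨c, hc, hg⟩ := tors _ hxg
      rw [hg]
      refine Submodule.sum_mem _ fun i _ => ?_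
      obtain ⟨a, y, hi⟩ := hspan i
      obtain ⟨d, hd⟩ : ∃ d, d = c i := ⟨_, rfl⟩
      obtain ⟨b, hb⟩ := left x hx hx0 (d * y) (Ideal.mul_mem_right _ _ (hd ▸ hc i))
      change c i • i ∈ _
      rw [← hd]
      rw [hi, smul_add, smul_smul, smul_smul, ← hb, mul_smul b, hxg, smul_zero, add_zero]
      exact Submodule.smul_mem _ _ hz
    intro z _
    obtain ⟨c, y, rfl⟩ := hspan z
    exact add_mem (Submodule.smul_mem _ _ hz) (Submodule.smul_mem _ _ hg1)

end Necessity

/-! ### From an abstract triangulation to the case condition and back -/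

section Cones

attribute [local instance] idShift

variable {R : Type u} [Ring R] {P : ObjectProperty (ModuleCat.{u} R)}

/-- The morphism from `R` given by an element. -/
abbrev ofElem (hR : P (ModuleCat.of R R)) (M : P.FullSubcategory) (m : M.obj) : regObj hR ⟶ M :=
  ofLin (M := regObj hR) (LinearMap.toSpanSingleton R M.obj m)

/-- Elements of a module are maps from `R`, so a weak kernel property tested on `R` is exactness. -/
theorem exact_of_factor (hR : P (ModuleCat.of R R)) {M N L : P.FullSubcategory}
    (f : M ⟶ N) (g : N ⟶ L) (hfg : f ≫ g = 0)
    (H : ∀ k : regObj hR ⟶ N, k ≫ g = 0 → ∃ k', k = k' ≫ f) :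
    Function.Exact (lin f) (lin g) := by
  intro n
  constructor
  · intro hn
    obtain ⟨k', hk⟩ := H (ofElem hR N n) (hom_ext_lin fun m : R => by
      change lin g (m • n) = 0
      rw [map_smul, hn, smul_zero])
    refine ⟨lin k' (1 : R), ?_⟩
    have h1 : (1 : R) • n = lin f (lin k' (1 : R)) :=
      LinearMap.congr_fun (congrArg (fun φ => lin (M := regObj hR) φ) hk) (1 : R)
    rw [← h1, one_smul]
  · rintro ⟨m, rfl⟩
    exact LinearMap.congr_fun (congrArg lin hfg) m

variable [P.ContainsZero]

section Exact

variable (hR : P (ModuleCat.of R R)) [p : Pretriangulated P.FullSubcategory]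
  {T : IdTriangle P.FullSubcategory} (hT : T ∈ distTriang P.FullSubcategory)

include hR hT

theorem exact₁₂_of_distTriang : Function.Exact (lin T.mor₁) (lin T.mor₂) :=
  exact_of_factor hR _ _ (comp_distTriang_mor_zero₁₂ T hT) fun k hk =>
    Triangle.coyoneda_exact₂ T hT k hk

theorem exact₂₃_of_distTriang : Function.Exact (lin T.mor₂) (lin₃ T) :=
  exact_of_factor (L := T.obj₁) hR _ _ (comp_distTriang_mor_zero₂₃ T hT) fun k hk =>
    Triangle.coyoneda_exact₃ T hT k hk

theorem exact₃₁_of_distTriang : Function.Exact (lin₃ T) (lin T.mor₁) :=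
  exact_of_factor (N := T.obj₁) (L := T.obj₂) hR _ _ (comp_distTriang_mor_zero₃₁ T hT) fun k hk =>
    Triangle.coyoneda_exact₁ T hT k hk

end Exact

/-- The isomorphism given by a linear equivalence. -/
def isoOfLinEquiv {M N : P.FullSubcategory} (e : M.obj ≃ₗ[R] N.obj) : M ≅ N where
  hom := ofLin e.toLinearMap
  inv := ofLin e.symm.toLinearMap
  hom_inv_id := hom_ext_lin e.symm_apply_apply
  inv_hom_id := hom_ext_lin e.apply_symm_apply

theorem caseCondition_of_admitsTriangulation [IsLocalRing R] (hS : SquareZeroSimple R)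
    (hR : P (ModuleCat.of R R)) (hP : ∀ M, P M → Module.Projective R M)
    (H : AdmitsTriangulation P.FullSubcategory) : CaseCondition hS := by
  obtain ⟨-, p, -, -⟩ := H
  by_cases hm : maxIdeal R = ⊥
  · exact Or.inl hm
  obtain ⟨x, hx, hx0⟩ := Submodule.exists_mem_ne_zero_of_ne_bot hm
  obtain ⟨Z, g, h, hT⟩ := distinguished_cocone_triangle (mulRightHom hR x)
  have := hP _ Z.2
  let g' : R →ₗ[R] Z.obj := lin g
  let h' : Z.obj →ₗ[R] R := lin (N := regObj hR) h
  have fg : Function.Exact (LinearMap.toSpanSingleton R R x) g' := exact₁₂_of_distTriang hR hT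
  have gh : Function.Exact g' h' := exact₂₃_of_distTriang hR hT
  have hf : Function.Exact h' (LinearMap.toSpanSingleton R R x) := exact₃₁_of_distTriang hR hT
  obtain ⟨z₀, hz₀⟩ : ∃ z₀, h' z₀ = x := (hf x).1 (hS.sq_zero x hx x hx)
  let e := LinearEquiv.ofBijective _ (hS.bijective_toSpanSingleton hx hx0 fg gh hf hz₀)
  have he : ∀ c : R, e c = c • z₀ := fun c => rfl
  obtain ⟨y₀, hy₀⟩ := e.surjective (g' 1)
  have hT' : Triangle.mk (mulRightHom hR x) (mulRightHom hR y₀) (mulRightHom hR x) ∈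
      distTriang P.FullSubcategory := by
    refine isomorphic_distinguished _ hT _ (Triangle.isoMk _ _ (Iso.refl _) (Iso.refl _)
      (isoOfLinEquiv (M := regObj hR) e) ?_ ?_ ?_)
    · rfl
    · refine hom_ext_lin fun m : R => ?_
      have : (m * y₀) • z₀ = g' m := by
        rw [mul_smul, ← he, hy₀, ← map_smul, smul_eq_mul, mul_one]
      exact this
    · refine hom_ext_lin (M := regObj hR) (N := regObj hR) fun m : R => ?_
      have : m * x = h' (m • z₀) := by rw [map_smul, hz₀, smul_eq_mul]
      exact this
  have fg' : Function.Exact (LinearMap.toSpanSingleton R R x)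
      (LinearMap.toSpanSingleton R R y₀) := exact₁₂_of_distTriang hR hT'
  obtain ⟨ρ, rfl⟩ : ∃ ρ, ρ * x = y₀ := by
    have h1 : x * y₀ = 0 := (fg' x).2 ⟨1, one_mul x⟩
    have h2 : y₀ ∈ (maxIdeal R : Set R) :=
      (mem_maxIdeal_iff y₀).2 fun hu => hx0 ((hu.mul_left_eq_zero).1 h1)
    rwa [hS.eq_left x hx hx0] at h2
  -- If the second map vanished, exactness would make right multiplication by `x` surjective.
  have hρ : ρ * x ≠ 0 := by
    intro h0
    obtain ⟨v, hv⟩ := (fg' (1 : R)).1 (by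
      change (1 : R) * (ρ * x) = 0
      rw [h0, mul_zero])
    have hv' : v * x = (1 : R) := hv
    have h1 : (1 : R) ∈ maxIdeal R := hv' ▸ Ideal.mul_mem_left _ _ hx
    exact (mem_maxIdeal_iff _).1 h1 isUnit_one
  obtain ⟨h2, ht⟩ := hS.isTwist_of_forall hx hx0 hρ fun a₁ a₂ ha => by
    obtain ⟨c, hc, hc'⟩ := complete_distinguished_triangle_morphism _ _ hT'
      (rot_of_distTriang _ hT') (mulRightHom hR a₁) (mulRightHom hR a₂)
      (hom_ext_lin (M := regObj hR) (N := regObj hR) fun m : R => by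
        change m * x * a₂ = m * a₁ * (ρ * x)
        rw [mul_assoc, ha, mul_assoc])
    have hlin : ∀ m : R, lin (M := regObj hR) (N := regObj hR) c m =
        m * lin (M := regObj hR) (N := regObj hR) c (1 : R) := by
      intro m
      rw [← smul_eq_mul, ← map_smul, smul_eq_mul, mul_one]
    refine ⟨lin (M := regObj hR) (N := regObj hR) c (1 : R), ?_, ?_⟩
    · have h3 : lin (M := regObj hR) (N := regObj hR) c ((1 : R) * (ρ * x)) = (1 : R) * a₂ * x :=
        LinearMap.congr_fun (congrArg (fun φ => lin (M := regObj hR) (N := regObj hR) φ) hc) (1 : R)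
      rwa [one_mul, one_mul, hlin] at h3
    · have h3 : (1 : R) * x * a₁ = -(lin (M := regObj hR) (N := regObj hR) c (1 : R) * x) :=
        LinearMap.congr_fun (congrArg (fun φ => lin (M := regObj hR) (N := regObj hR) φ) hc') (1 : R)
      rwa [one_mul] at h3
  exact hS.caseCondition_of_isTwist hx hx0 h2 ht

theorem exists_setup_of_caseCondition [IsLocalRing R] (hS : SquareZeroSimple R)
    (H : CaseCondition hS) : ∃ x r : R, Setup x r := by
  by_cases hm : maxIdeal R = ⊥
  · exact ⟨0, 1, setup_of_eq_bot hm⟩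
  rcases H with h | h | ⟨h2, x, hx, hx0, r, hr⟩
  · exact absurd h hm
  · have h2 := two_mem_of_maxIdealEqTwo h
    have h20 := two_ne_zero_of_maxIdealEqTwo h hm
    exact ⟨2, 1, hS.setup h2 h20 h2 (isTwist_two hS h2 h20
      (one_mem (Subring.center (Residue R))) (one_ne_zero (α := Residue R)))⟩
  · obtain ⟨r, rfl⟩ := Ideal.Quotient.mk_surjective r
    exact ⟨x, r, hS.setup hx hx0 (by rw [← one_add_one_eq_two, h2]; exact zero_mem _) hr⟩

end Cones

end LocalTriang

theorem mainTheorem1 {R : Type u} [Ring R] [IsLocalRing R]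
    (hR : LocalTriang.SquareZeroSimple R) :
    -- existence of a triangulation, in both categories
    (LocalTriang.AdmitsTriangulation (LocalTriang.ProjCat R) ↔ LocalTriang.CaseCondition hR) ∧
    (LocalTriang.AdmitsTriangulation (LocalTriang.FGProjCat R) ↔
      LocalTriang.CaseCondition hR) ∧
    -- the explicit triangulation, from any admissible pair `x`, `r`, in the last two cases
    (LocalTriang.MaxIdealEqTwo R ∨ (1 : R) + 1 = 0 →
      ∀ (x : R) (hx : x ∈ LocalTriang.maxIdeal R) (hx0 : x ≠ 0) (r : R),
        LocalTriang.IsTwist hR hx hx0 (LocalTriang.res r) →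
          LocalTriang.IsTriangulation (LocalTriang.projTriangles x r) ∧
          LocalTriang.IsTriangulation (LocalTriang.fgProjTriangles x r)) ∧
    -- if `𝔪 = 2R ≠ 0`, the element `2` and any nonzero central element of `d` are admissible
    (LocalTriang.MaxIdealEqTwo R → LocalTriang.maxIdeal R ≠ ⊥ →
      ∃ (h2 : (2 : R) ∈ LocalTriang.maxIdeal R) (h20 : (2 : R) ≠ 0),
        ∀ c ∈ Subring.center (LocalTriang.Residue R), c ≠ 0 →
          LocalTriang.IsTwist hR h2 h20 c) := by
  refine ⟨⟨?_, ?_⟩, ⟨?_, ?_⟩, ?_, ?_⟩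
  · exact LocalTriang.caseCondition_of_admitsTriangulation hR (LocalTriang.isProj_self R)
      fun _ h => h
  · intro H
    obtain ⟨x, r, S⟩ := LocalTriang.exists_setup_of_caseCondition hR H
    exact ⟨_, S.isTriangulation_eTriangles_isProj⟩
  · exact LocalTriang.caseCondition_of_admitsTriangulation hR (LocalTriang.isFGProj_self R)
      fun _ h => h.1
  · intro H
    obtain ⟨x, r, S⟩ := LocalTriang.exists_setup_of_caseCondition hR H
    exact ⟨_, S.isTriangulation_eTriangles_isFGProj⟩
  · intro h x hx hx0 r hr
    have h2 : (2 : R) ∈ LocalTriang.maxIdeal R := by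
      rcases h with h | h
      · exact LocalTriang.two_mem_of_maxIdealEqTwo h
      · rw [← one_add_one_eq_two, h]
        exact zero_mem _
    have S := hR.setup hx hx0 h2 hr
    rw [← S.eTriangles_isProj hx0, ← S.eTriangles_isFGProj hx0]
    exact ⟨S.isTriangulation_eTriangles_isProj, S.isTriangulation_eTriangles_isFGProj⟩
  · intro h hb
    exact ⟨LocalTriang.two_mem_of_maxIdealEqTwo h, LocalTriang.two_ne_zero_of_maxIdealEqTwo h hb,
      fun c hc hc0 => LocalTriang.isTwist_two hR _ _ hc hc0⟩
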